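/- Let $P(2,\mathbb{Q})=\{h\in \mathrm{GL}(2,\mathbb{Q}) : |\det h|>1\}\cup \mathrm{GL}(2,\mathbb{Z})$, a submonoid of $\mathrm{GL}(2,\mathbb{Q})$. For a monoid $N$, let $\mathrm{Rat}(N)$ be the smallest family of subsets of $N$ that contains all finite subsets and is closed under union, product $K\cdot L$ and Kleene star ($L^*$ is the submonoid generated by $L$). A subset $R\subseteq \mathrm{GL}(2,\mathbb{Q})$ is called flat rational relative to $P(2,\mathbb{Q})$ if it is a finite union of sets of the form $L_0g_1L_1\cdots g_tL_t$ with $t\ge 0$, $L_0,\dots,L_t\in \mathrm{Rat}(P(2,\mathbb{Q}))$ and $g_1,\dots,g_t\in \mathrm{GL}(2,\mathbb{Q})$; such a set is described by a flat rational expression, that is, by the list of its terms, each consisting of the matrices $g_i$ and of rational expressions for the $L_i$ whose letters are matrices in $P(2,\mathbb{Q})$. The membership problem for these sets is decidable: every flat rational subset $R$ of $\mathrm{GL}(2,\mathbb{Q})$ relative to $P(2,\mathbb{Q})$ is described by a flat rational expression, and there is a single algorithm which, given any $g\in \mathrm{GL}(2,\mathbb{Q})$ and any flat rational expression for such a set $R$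 (all matrices being given by their entries as reduced fractions), decides whether $g\in R$. -/

import Mathlib

open scoped Pointwise

namespace FlatRat

/-! ### Rational and flat rational subsets of a monoid -/

/-- `Rat(M)`: the least family of subsets of `M` containing the finite subsets and closed under
union, product and Kleene star (`L*` is the submonoid generated by `L`). -/
inductive IsRational {M : Type*} [Monoid M] : Set M → Prop
  | finite (L : Set M) : L.Finite → IsRational L
  | union (K L : Set M) : IsRational K → IsRational L → IsRational (K ∪ L)
  | mul (K L : Set M) : IsRational K → IsRational L → IsRational (K * L)
  | star (L : Set M) : IsRational L → IsRational (Submonoid.closure L : Set M)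

/-- The set `L₀ g₁ L₁ ⋯ g_t L_t ⊆ M`, where `L₀, …, L_t ⊆ N`; the list holds the pairs
`(g₁, L₁), …, (g_t, L_t)`. -/
def flatProduct {M : Type*} [Monoid M] (N : Submonoid M) (L₀ : Set N) (l : List (M × Set N)) :
    Set M :=
  ((↑) '' L₀ : Set M) * (l.map fun p => ({p.1} : Set M) * ((↑) '' p.2 : Set M)).prod

/-- `L` is a flat rational subset of `M` relative to the submonoid `N`: a finite union of sets
`L₀ g₁ L₁ ⋯ g_t L_t` with all `L_i ∈ Rat(N)` and all `g_i ∈ M`. -/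
def IsFlatRational {M : Type*} [Monoid M] (N : Submonoid M) (L : Set M) : Prop :=
  ∃ F : List (Set N × List (M × Set N)),
    (∀ T ∈ F, IsRational T.1 ∧ ∀ p ∈ T.2, IsRational p.2) ∧
    L = ⋃ T ∈ F, flatProduct N T.1 T.2

/-! ### Expressions for such sets -/

/-- The rational subset of `M` described by a rational expression with letters in `M`. -/
def ratSet {M : Type*} [Monoid M] : RegularExpression M → Set M
  | .zero => ∅
  | .epsilon => {1}
  | .char a => {a}
  | .plus E F => ratSet E ∪ ratSet F
  | .comp E F => ratSet E * ratSet F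
  | .star E => (Submonoid.closure (ratSet E) : Set M)

/-- Expressions for flat rational sets: finite lists (unions) of terms `E₀ g₁ E₁ ⋯ g_t E_t`, with
`g_i` from `A` and `E_i` rational expressions over `B`. -/
abbrev FlatExpr (A B : Type*) : Type _ :=
  List (RegularExpression B × List (A × RegularExpression B))

/-- The subset of `M` described by a flat rational expression. -/
def flatSet {M : Type*} [Monoid M] (N : Submonoid M) (E : FlatExpr M N) : Set M :=
  ⋃ T ∈ E, flatProduct N (ratSet T.1) (T.2.map fun p => (p.1, ratSet p.2))

/-- Letter-by-letter translation of flat rational expressions. -/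
def FlatExpr.mapLetters {A B A' B' : Type*} (f : A → A') (h : B → B') (E : FlatExpr A B) :
    FlatExpr A' B' :=
  List.map (fun T => (T.1.map h, List.map (fun p => (f p.1, p.2.map h)) T.2)) E

/-! ### Numbering rational expressions by natural numbers -/

section Coding

variable {α : Type*} [Denumerable α]

/-- The number of a rational expression over a numbered alphabet. -/
def encodeRegex : RegularExpression α → ℕ
  | .zero => 0
  | .epsilon => 1
  | .char a => 4 * Encodable.encode a + 2
  | .plus E F => 4 * Nat.pair (encodeRegex E) (encodeRegex F) + 3
  | .comp E F => 4 * Nat.pair (encodeRegex E) (encodeRegex F) + 4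
  | .star E => 4 * encodeRegex E + 5

/-- The inverse of `encodeRegex`. -/
def ofNatRegex (α : Type*) [Denumerable α] : ℕ → RegularExpression α
  | 0 => .zero
  | 1 => .epsilon
  | n + 2 =>
    have h₁ : (n / 4).unpair.1 < n + 2 :=
      lt_of_le_of_lt (Nat.unpair_left_le _) (by omega)
    have h₂ : (n / 4).unpair.2 < n + 2 :=
      lt_of_le_of_lt (Nat.unpair_right_le _) (by omega)
    have h₃ : n / 4 < n + 2 := by omega
    if n % 4 = 0 then .char (Denumerable.ofNat α (n / 4))
    else if n % 4 = 1 then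
      .plus (ofNatRegex α (n / 4).unpair.1) (ofNatRegex α (n / 4).unpair.2)
    else if n % 4 = 2 then
      .comp (ofNatRegex α (n / 4).unpair.1) (ofNatRegex α (n / 4).unpair.2)
    else .star (ofNatRegex α (n / 4))

theorem ofNatRegex_encodeRegex (E : RegularExpression α) : ofNatRegex α (encodeRegex E) = E := by
  induction E with
  | zero => rw [encodeRegex, ofNatRegex]
  | epsilon => rw [encodeRegex, ofNatRegex]
  | char a =>
    have h : (4 * Encodable.encode a) / 4 = Encodable.encode a := by omega
    rw [encodeRegex, ofNatRegex, if_pos (by omega), h, Denumerable.ofNat_encode]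
  | plus E F hE hF =>
    have h (k : ℕ) : (4 * k + 1) / 4 = k := by omega
    rw [encodeRegex, ofNatRegex, if_neg (by omega), if_pos (by omega), h, Nat.unpair_pair, hE, hF]
  | comp E F hE hF =>
    have h (k : ℕ) : (4 * k + 2) / 4 = k := by omega
    rw [encodeRegex, ofNatRegex, if_neg (by omega), if_neg (by omega), if_pos (by omega), h,
      Nat.unpair_pair, hE, hF]
  | star E hE =>
    have h (k : ℕ) : (4 * k + 3) / 4 = k := by omega
    rw [encodeRegex, ofNatRegex, if_neg (by omega), if_neg (by omega), if_neg (by omega), h, hE]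

theorem encodeRegex_ofNatRegex (n : ℕ) : encodeRegex (ofNatRegex α n) = n := by
  induction n using Nat.strong_induction_on with
  | _ n ih =>
    match n with
    | 0 => rw [ofNatRegex, encodeRegex]
    | 1 => rw [ofNatRegex, encodeRegex]
    | n + 2 =>
      have h₁ : (n / 4).unpair.1 < n + 2 :=
        lt_of_le_of_lt (Nat.unpair_left_le _) (by omega)
      have h₂ : (n / 4).unpair.2 < n + 2 :=
        lt_of_le_of_lt (Nat.unpair_right_le _) (by omega)
      have h₃ : n / 4 < n + 2 := by omega
      rw [ofNatRegex]
      split_ifs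
      · rw [encodeRegex, Denumerable.encode_ofNat]; omega
      · rw [encodeRegex, ih _ h₁, ih _ h₂, Nat.pair_unpair]; omega
      · rw [encodeRegex, ih _ h₁, ih _ h₂, Nat.pair_unpair]; omega
      · rw [encodeRegex, ih _ h₃]; omega

instance instDenumerableRegex : Denumerable (RegularExpression α) :=
  Denumerable.mk'
    ⟨encodeRegex, ofNatRegex α, ofNatRegex_encodeRegex, encodeRegex_ofNatRegex⟩

end Coding

/-! ### `GL(2,ℚ)` and the submonoid `P(2,ℚ)` -/

/-- `GL(2,ℤ)` as a subgroup of `GL(2,ℚ)`. -/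
def GL2Z : Subgroup (Matrix.GeneralLinearGroup (Fin 2) ℚ) :=
  (Matrix.GeneralLinearGroup.map (n := Fin 2) (Int.castRingHom ℚ)).range

theorem abs_det_of_mem_GL2Z {h : Matrix.GeneralLinearGroup (Fin 2) ℚ} (hh : h ∈ GL2Z) :
    |(h : Matrix (Fin 2) (Fin 2) ℚ).det| = 1 := by
  obtain ⟨a, rfl⟩ := hh
  have h1 : IsUnit (a : Matrix (Fin 2) (Fin 2) ℤ).det :=
    (Matrix.isUnit_iff_isUnit_det _).1 a.isUnit
  have h2 : (Matrix.GeneralLinearGroup.map (n := Fin 2) (Int.castRingHom ℚ) a :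
      Matrix (Fin 2) (Fin 2) ℚ).det = ((a : Matrix (Fin 2) (Fin 2) ℤ).det : ℚ) := by
    simp [Matrix.det_fin_two]
  rw [h2]
  rcases Int.isUnit_iff.1 h1 with h | h <;> simp [h]

/-- `P(2,ℚ) = {h ∈ GL(2,ℚ) : |det h| > 1} ∪ GL(2,ℤ)`. -/
def P2Q : Submonoid (Matrix.GeneralLinearGroup (Fin 2) ℚ) where
  carrier := {h | 1 < |(h : Matrix (Fin 2) (Fin 2) ℚ).det|} ∪ GL2Z
  one_mem' := Or.inr GL2Z.one_mem
  mul_mem' := by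
    rintro a b (ha | ha) (hb | hb)
    · left
      simp only [Set.mem_ofPred_eq, Matrix.GeneralLinearGroup.coe_mul, Matrix.det_mul,
        abs_mul] at *
      nlinarith
    · left
      have := abs_det_of_mem_GL2Z hb
      simp only [Set.mem_ofPred_eq, Matrix.GeneralLinearGroup.coe_mul, Matrix.det_mul,
        abs_mul] at *
      rwa [this, mul_one]
    · left
      have := abs_det_of_mem_GL2Z ha
      simp only [Set.mem_ofPred_eq, Matrix.GeneralLinearGroup.coe_mul, Matrix.det_mul,
        abs_mul] at *
      rwa [this, one_mul]
    · exact Or.inr (GL2Z.mul_mem ha hb)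

/-! ### Finite descriptions of the inputs -/

/-- Finite data describing a rational `2 × 2` matrix: its rows, each entry being given by
numerator and denominator. -/
abbrev MatCode : Type :=
  ((ℤ × ℕ) × (ℤ × ℕ)) × ((ℤ × ℕ) × (ℤ × ℕ))

/-- A rational number as its reduced numerator and positive denominator. -/
def ratCode (q : ℚ) : ℤ × ℕ :=
  (q.num, q.den)

/-- The description of a matrix in `GL(2,ℚ)` by its four entries. -/
def matCode (g : Matrix.GeneralLinearGroup (Fin 2) ℚ) : MatCode :=
  ((ratCode (g.1 0 0), ratCode (g.1 0 1)), (ratCode (g.1 1 0), ratCode (g.1 1 1)))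

/-- The description of a flat rational expression of `GL(2,ℚ)` relative to `P(2,ℚ)`: every matrix
in it is replaced by its description. -/
def flatCode (E : FlatExpr (Matrix.GeneralLinearGroup (Fin 2) ℚ) P2Q) :
    FlatExpr MatCode MatCode :=
  FlatExpr.mapLetters matCode (fun h : P2Q => matCode h) E

end FlatRat

/-! Scalars are central, so multiplying every `g_i` of a term by a common denominator, and the
tested matrix by the product of these denominators, does not change membership. The new `g_i` are
integral with nonzero determinant and hence lie in `P(2,ℚ)`. Each term thus becomes a rational
subset of `P(2,ℚ)`.

Unfolding the expression one step at a time gives a graph on finitely many residual products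
(`finite_setOf_path`), whose steps split off matrices of `P(2,ℚ)`. Enumerating its paths
semi-decides membership. For nonmembership only prefixes with `|det| ≤ |det g|` matter, since
determinants never decrease along a path. A letter outside `GL(2,ℤ)` multiplies `|det|` by at least
a fixed `δ > 1`, so few of them occur and all relevant prefixes have a common denominator
(`exists_common_denominator`). Integral matrices of bounded nonzero determinant fall into finitely
many classes under left multiplication by the Sanov subgroup, which is given by congruences in
`SL(2,ℤ)` and is free. So finitely many nodes suffice up to Sanov factors (`exists_finite_cover`),
and the question becomes one about a finite graph with edges labelled in a free group.

Such a graph is handled by saturation inside a ball. If the factors of a product and the product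
itself lie in a ball of the Cayley tree, some two adjacent factors multiply into the ball
(`exists_adjacent_mul_norm_le`). An edge set closed under compositions staying in the ball therefore
already contains every composition ending there (`edge_of_edgePath`). A finite closed graph without
the forbidden edge is a checkable proof of nonmembership: it is sound by `Cert.Refutes.notMem` and
exists whenever needed by `exists_refutes`. Both searches are over primitive recursive relations, so
running them together decides membership. -/

namespace FlatRat

/-! ### Geometry of the word length in a free group -/

section FreeGroup

variable {α : Type*} [DecidableEq α]

/-- The length of the longest common prefix of two lists. -/
def commonPrefixLength {β : Type*} [DecidableEq β] : List β → List β → ℕ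
  | a :: l, b :: m => if a = b then commonPrefixLength l m + 1 else 0
  | _, _ => 0

/-- This is the ultrametric form of the statement that the Cayley graph is a tree: the common prefix
length is the Gromov product based at the origin. -/
theorem min_commonPrefixLength_le {β : Type*} [DecidableEq β] (l m n : List β) :
    min (commonPrefixLength l m) (commonPrefixLength m n) ≤ commonPrefixLength l n := by
  induction l generalizing m n with
  | nil => simp [commonPrefixLength]
  | cons a l ih =>
    match m, n with
    | [], _ => simp [commonPrefixLength]
    | b :: m, [] => simp [commonPrefixLength]
    | b :: m, c :: n =>
      simp only [commonPrefixLength]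
      have := ih m n
      split_ifs <;> simp_all

-- Stripping equal first letters accounts for all cancellation: once the first letters differ, the
-- inverse of one word followed by the other is reduced. So distances in the tree are determined by
-- lengths and common prefixes.
open FreeGroup in
theorem norm_inv_mul_mk {L M : List (α × Bool)} (hL : IsReduced L) (hM : IsReduced M) :
    FreeGroup.norm ((mk L)⁻¹ * mk M) + 2 * commonPrefixLength L M = L.length + M.length := by
  induction L generalizing M with
  | nil =>
    have h : FreeGroup.norm (mk M) = M.length := by rw [FreeGroup.norm, toWord_mk, hM.reduce_eq]
    have h1 : (mk ([] : List (α × Bool)))⁻¹ = 1 := by rw [← one_eq_mk, inv_one]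
    simp [h1, h, commonPrefixLength]
  | cons a L ih =>
    match M, hM with
    | [], _ =>
      have h1 : mk ([] : List (α × Bool)) = 1 := one_eq_mk.symm
      rw [h1, mul_one, norm_inv_eq, FreeGroup.norm, toWord_mk, hL.reduce_eq]
      simp [commonPrefixLength]
    | b :: M, hM =>
      have hL' : IsReduced L := hL.infix ⟨[a], [], by simp⟩
      have hM' : IsReduced M := hM.infix ⟨[b], [], by simp⟩
      by_cases hab : a = b
      · subst hab
        have h : (mk (a :: L))⁻¹ * mk (a :: M) = (mk L)⁻¹ * mk M := by
          have e (l : List (α × Bool)) : mk (a :: l) = mk [a] * mk l := by rw [mul_mk]; rfl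
          rw [e L, e M]; group
        have := ih hL' hM'
        rw [h]
        simp only [commonPrefixLength, if_true, List.length_cons]
        omega
      · have hr : IsReduced (invRev (a :: L) ++ (b :: M)) := by
          have e1 : invRev (a :: L) = invRev L ++ [(a.1, !a.2)] := by simp [invRev]
          have h1 : IsReduced (invRev (a :: L)) := by
            rw [isReduced_iff_reduce_eq, reduce_invRev, hL.reduce_eq]
          have h2 : IsReduced ([(a.1, !a.2)] ++ (b :: M)) := by
            rw [List.singleton_append, FreeGroup.IsReduced, List.isChain_cons_cons]
            refine ⟨fun h => ?_, hM⟩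
            rcases a with ⟨a, x⟩
            rcases b with ⟨b, y⟩
            simp only at h
            subst h
            cases x <;> cases y <;> simp_all
          rw [e1] at h1 ⊢
          exact h1.append_overlap h2 (by simp)
        rw [inv_mk, mul_mk, FreeGroup.norm, toWord_mk, hr.reduce_eq]
        simp [commonPrefixLength, hab, invRev_length]

theorem norm_inv_mul (x y : FreeGroup α) :
    (x⁻¹ * y).norm + 2 * commonPrefixLength x.toWord y.toWord = x.norm + y.norm := by
  have := norm_inv_mul_mk (α := α) (L := x.toWord) (M := y.toWord)
    FreeGroup.isReduced_toWord FreeGroup.isReduced_toWord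
  simpa [FreeGroup.mk_toWord, FreeGroup.norm] using this

/-- A vertex which is at least as far from the origin as two others near it keeps these two near
to each other. -/
theorem norm_inv_mul_le_of_norm_le {p z q : FreeGroup α} {N : ℕ} (hp : p.norm ≤ z.norm)
    (hq : q.norm ≤ z.norm) (hpz : (p⁻¹ * z).norm ≤ N) (hzq : (z⁻¹ * q).norm ≤ N) :
    (p⁻¹ * q).norm ≤ N := by
  have h1 := norm_inv_mul p z
  have h2 := norm_inv_mul z q
  have h3 := norm_inv_mul p q
  have h4 := min_commonPrefixLength_le p.toWord z.toWord q.toWord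
  -- Twice the common prefix of `p, z` is at least `|p| + |z| - N`, and similarly for `z, q`. The
  -- ultrametric inequality bounds the distance of `p, q` by `N + max (|p| - |z|) (|q| - |z|)`,
  -- which is at most `N`.
  omega

/-- The partial products never turn back towards the origin. At a turning point, `p * x` would be at
least as far out as both of its neighbours `p` and `p * x * y`, forcing the adjacent product `x * y`
into the ball. -/
theorem norm_le_norm_mul_prod {N : ℕ} (l : List (FreeGroup α)) (x p : FreeGroup α)
    (hl : ∀ y ∈ x :: l, y.norm ≤ N) (hp : p.norm ≤ (p * x).norm)
    (hadj : (x :: l).IsChain fun y z => N < (y * z).norm) :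
    (p * x).norm ≤ (p * x * l.prod).norm := by
  induction l generalizing x p with
  | nil => simp
  | cons y l ih =>
    rw [List.isChain_cons_cons] at hadj
    have hlt : (p * x).norm ≤ (p * x * y).norm := by
      by_contra hcon
      have := norm_inv_mul_le_of_norm_le (N := N) hp (not_le.1 hcon).le
        (by simpa using hl x (by simp))
        (by rw [inv_mul_cancel_left]; exact hl y (by simp))
      rw [show p⁻¹ * (p * x * y) = x * y by group] at this
      exact absurd hadj.1 (not_lt.2 this)
    have := ih y (p * x) (fun z hz => hl z (List.mem_cons_of_mem _ hz)) hlt hadj.2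
    rw [List.prod_cons, ← mul_assoc]
    exact hlt.trans this

/-- If the factors of a product in a free group and the product itself lie in a ball, then so does
the product of some two adjacent factors. -/
theorem exists_adjacent_mul_norm_le {N : ℕ} (l : List (FreeGroup α)) (hl : ∀ y ∈ l, y.norm ≤ N)
    (hlen : 2 ≤ l.length) (hprod : l.prod.norm ≤ N) :
    ∃ l₁ x y l₂, l = l₁ ++ x :: y :: l₂ ∧ (x * y).norm ≤ N := by
  by_contra! hcon
  have hadj : l.IsChain fun y z => N < (y * z).norm := by
    rw [List.isChain_iff_forall_rel_of_append_cons_cons]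
    exact fun {a b l₁ l₂} h => hcon l₁ a b l₂ h
  match l, hlen, hl, hprod, hadj with
  | x :: y :: l, _, hl, hprod, hadj =>
    rw [List.isChain_cons_cons] at hadj
    -- The walk starts outwards, since `x` is in the ball and `x * y` is not. Hence it ends outside
    -- the ball.
    have hlt : x.norm ≤ (x * y).norm := (hl x (by simp)).trans hadj.1.le
    have := norm_le_norm_mul_prod l y x (fun z hz => hl z (List.mem_cons_of_mem _ hz)) hlt hadj.2
    rw [List.prod_cons, List.prod_cons, ← mul_assoc] at hprod
    exact absurd (this.trans hprod) (not_le.2 hadj.1)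

/-! ### Saturation of edge-labelled graphs over a free group -/

/-- `l` labels a sequence of `T`-edges from `u` to `v`. -/
def EdgePath {ι G : Type*} (T : ι → G → ι → Prop) : ι → List G → ι → Prop
  | u, [], v => u = v
  | u, x :: l, v => ∃ m, T u x m ∧ EdgePath T m l v

theorem edgePath_append {ι G : Type*} {T : ι → G → ι → Prop} {u v : ι} {l m : List G} :
    EdgePath T u (l ++ m) v ↔ ∃ w, EdgePath T u l w ∧ EdgePath T w m v := by
  induction l generalizing u with
  | nil => simp [EdgePath]
  | cons x l ih => simp only [List.cons_append, EdgePath, ih]; tauto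

/-- A set of edges labelled in a ball of a free group and closed under the compositions which stay
in the ball contains all compositions of its edges which end in the ball. -/
theorem edge_of_edgePath {ι : Type*} {T : ι → FreeGroup α → ι → Prop} {N : ℕ}
    (hN : ∀ u x v, T u x v → x.norm ≤ N)
    (hT : ∀ u x v y w, T u x v → T v y w → (x * y).norm ≤ N → T u (x * y) w)
    {u v : ι} (hu : T u 1 u) {l : List (FreeGroup α)} (hl : EdgePath T u l v)
    (hprod : l.prod.norm ≤ N) : T u l.prod v := by
  induction hn : l.length using Nat.strong_induction_on generalizing l with
  | _ n ih =>
    match l, hl with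
    | [], hl => cases hl; simpa using hu
    | [x], ⟨m, hx, hm⟩ => cases hm; simpa using hx
    | x :: y :: l, hl =>
      have hmem : ∀ (l : List (FreeGroup α)) u, EdgePath T u l v → ∀ z ∈ l, z.norm ≤ N := by
        intro l
        induction l with
        | nil => simp
        | cons a l ihl =>
          rintro u ⟨m, ha, hm⟩ z hz
          rcases List.mem_cons.1 hz with rfl | hz
          · exact hN _ _ _ ha
          · exact ihl m hm z hz
      -- Contracting two adjacent edges whose labels multiply into the ball shortens the sequence
      -- and keeps its product, so induction on the length applies.
      obtain ⟨l₁, a, b, l₂, he, hab⟩ := exists_adjacent_mul_norm_le _ (hmem _ _ hl)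
        (by simp) hprod
      rw [he] at hl hprod hn ⊢
      obtain ⟨w, h1, m, ha, m', hb, h2⟩ := edgePath_append.1 hl
      have hp : (l₁ ++ (a * b) :: l₂).prod = (l₁ ++ a :: b :: l₂).prod := by
        simp [mul_assoc]
      rw [← hp] at hprod ⊢
      refine ih (l₁ ++ (a * b) :: l₂).length ?_
        (edgePath_append.2 ⟨w, h1, m', hT _ _ _ _ _ ha hb hab, h2⟩) hprod rfl
      rw [← hn]; simp

end FreeGroup

end FlatRat

namespace FlatRat

/-! ### A free subgroup of `SL(2,ℤ)` -/

open Matrix MatrixGroups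

/-- The generators `(1 2; 0 1)` and `(1 0; 2 1)` of the Sanov subgroup. -/
def sanovGen : Bool → SL(2, ℤ)
  | true => ⟨!![1, 2; 0, 1], by simp [Matrix.det_fin_two]⟩
  | false => ⟨!![1, 0; 2, 1], by simp [Matrix.det_fin_two]⟩

/-- The representation of the free group of rank two by the Sanov subgroup. -/
def sanov : FreeGroup Bool →* SL(2, ℤ) := FreeGroup.lift sanovGen

/-- Attracting sets of the Sanov generators, in terms of the first column. -/
def sanovAttract : Bool → Set SL(2, ℤ)
  | true => {m | (m.1 1 0).natAbs ≤ (m.1 0 0).natAbs ∧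
      ((0 < m.1 0 0 ∧ 0 < m.1 1 0) ∨ (m.1 0 0 < 0 ∧ m.1 1 0 < 0))}
  | false => {m | (m.1 0 0).natAbs < (m.1 1 0).natAbs ∧
      ((0 < m.1 0 0 ∧ 0 < m.1 1 0) ∨ (m.1 0 0 < 0 ∧ m.1 1 0 < 0))}

/-- Repelling sets of the Sanov generators, in terms of the first column. -/
def sanovRepel : Bool → Set SL(2, ℤ)
  | true => {m | (m.1 1 0).natAbs < (m.1 0 0).natAbs ∧
      ¬((0 < m.1 0 0 ∧ 0 < m.1 1 0) ∨ (m.1 0 0 < 0 ∧ m.1 1 0 < 0))}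
  | false => {m | (m.1 0 0).natAbs ≤ (m.1 1 0).natAbs ∧
      ¬((0 < m.1 0 0 ∧ 0 < m.1 1 0) ∨ (m.1 0 0 < 0 ∧ m.1 1 0 < 0))}

theorem first_column_ne_zero (m : SL(2, ℤ)) : m.1 0 0 ≠ 0 ∨ m.1 1 0 ≠ 0 := by
  by_contra! h
  have := m.2
  rw [Matrix.det_fin_two, h.1, h.2] at this
  simp at this

theorem sanovGen_true_mul (m : SL(2, ℤ)) :
    (sanovGen true * m).1 = !![m.1 0 0 + 2 * m.1 1 0, m.1 0 1 + 2 * m.1 1 1; m.1 1 0, m.1 1 1] := by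
  rw [Matrix.SpecialLinearGroup.coe_mul]
  ext i j
  fin_cases i <;> fin_cases j <;> simp [sanovGen, Matrix.mul_apply, Fin.sum_univ_two]

theorem sanovGen_false_mul (m : SL(2, ℤ)) :
    (sanovGen false * m).1 =
      !![m.1 0 0, m.1 0 1; 2 * m.1 0 0 + m.1 1 0, 2 * m.1 0 1 + m.1 1 1] := by
  rw [Matrix.SpecialLinearGroup.coe_mul]
  ext i j
  fin_cases i <;> fin_cases j <;> simp [sanovGen, Matrix.mul_apply, Fin.sum_univ_two]

theorem sanovGen_true_inv_mul (m : SL(2, ℤ)) :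
    ((sanovGen true)⁻¹ * m).1 =
      !![m.1 0 0 - 2 * m.1 1 0, m.1 0 1 - 2 * m.1 1 1; m.1 1 0, m.1 1 1] := by
  rw [Matrix.SpecialLinearGroup.coe_mul, Matrix.SpecialLinearGroup.coe_inv]
  ext i j
  fin_cases i <;> fin_cases j <;>
    simp [sanovGen, Matrix.mul_apply, Fin.sum_univ_two, Matrix.adjugate_fin_two] <;> ring

theorem sanovGen_false_inv_mul (m : SL(2, ℤ)) :
    ((sanovGen false)⁻¹ * m).1 =
      !![m.1 0 0, m.1 0 1; m.1 1 0 - 2 * m.1 0 0, m.1 1 1 - 2 * m.1 0 1] := by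
  rw [Matrix.SpecialLinearGroup.coe_mul, Matrix.SpecialLinearGroup.coe_inv]
  ext i j
  fin_cases i <;> fin_cases j <;>
    simp [sanovGen, Matrix.mul_apply, Fin.sum_univ_two, Matrix.adjugate_fin_two] <;> ring

/-- Ping-pong for left multiplication, which acts on the first column `(a, c)`. The attracting and
repelling sets are separated by whether `a` and `c` have the same strict sign, and the two
generators by which entry dominates. Ties `|a| = |c|` go to `true` among the attracting sets and to
`false` among the repelling ones, because the `true` generator sends `(1, -1)` to `(-1, -1)`. -/
theorem sanov_injective : Function.Injective sanov := by
  refine FreeGroup.injective_lift_of_ping_pong sanovGen sanovAttract sanovRepel ?_ ?_ ?_ ?_ ?_ ?_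
  · rintro (_ | _)
    · refine ⟨⟨!![1, 1; 2, 3], by simp [Matrix.det_fin_two]⟩, ?_, ?_⟩ <;> simp
    · refine ⟨⟨!![2, 1; 1, 1], by simp [Matrix.det_fin_two]⟩, ?_, ?_⟩ <;> simp
  · rintro (_ | _) (_ | _) h
    · simp at h
    · exact Set.disjoint_left.2 fun m h1 h2 => absurd h1.1 (not_lt.2 h2.1)
    · exact Set.disjoint_left.2 fun m h1 h2 => absurd h2.1 (not_lt.2 h1.1)
    · simp at h
  · rintro (_ | _) (_ | _) h
    · simp at h
    · exact Set.disjoint_left.2 fun m h1 h2 => absurd h2.1 (not_lt.2 h1.1)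
    · exact Set.disjoint_left.2 fun m h1 h2 => absurd h1.1 (not_lt.2 h2.1)
    · simp at h
  · rintro (_ | _) (_ | _) <;> exact Set.disjoint_left.2 fun m h1 h2 => h2.2 h1.2
  · rintro (_ | _) _ ⟨m, hm, rfl⟩
    · have := first_column_ne_zero m
      simp only [sanovRepel, Set.mem_compl_iff, Set.mem_ofPred_eq] at hm
      change sanovGen false * m ∈ _
      simp only [sanovAttract, Set.mem_ofPred_eq, sanovGen_false_mul]
      simp
      omega
    · have := first_column_ne_zero m
      simp only [sanovRepel, Set.mem_compl_iff, Set.mem_ofPred_eq] at hm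
      change sanovGen true * m ∈ _
      simp only [sanovAttract, Set.mem_ofPred_eq, sanovGen_true_mul]
      simp
      omega
  · rintro (_ | _) _ ⟨m, hm, rfl⟩
    · have := first_column_ne_zero m
      simp only [sanovAttract, Set.mem_compl_iff, Set.mem_ofPred_eq] at hm
      change (sanovGen false)⁻¹ * m ∈ _
      simp only [sanovRepel, Set.mem_ofPred_eq, sanovGen_false_inv_mul]
      simp
      omega
    · have := first_column_ne_zero m
      simp only [sanovAttract, Set.mem_compl_iff, Set.mem_ofPred_eq] at hm
      change (sanovGen true)⁻¹ * m ∈ _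
      simp only [sanovRepel, Set.mem_ofPred_eq, sanovGen_true_inv_mul]
      simp
      omega

/-! ### The Sanov subgroup as a congruence condition -/

/-- The congruences which define the Sanov subgroup of `SL(2,ℤ)`. -/
def SanovCongr (m : SL(2, ℤ)) : Prop :=
  m.1 0 0 % 4 = 1 ∧ m.1 0 1 % 2 = 0 ∧ m.1 1 0 % 2 = 0 ∧ m.1 1 1 % 2 = 1

theorem SanovCongr.gen_mul {m : SL(2, ℤ)} (hm : SanovCongr m) (b : Bool) :
    SanovCongr (sanovGen b * m) ∧ SanovCongr ((sanovGen b)⁻¹ * m) := by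
  obtain ⟨h1, h2, h3, h4⟩ := hm
  cases b
  · simp only [SanovCongr, sanovGen_false_mul, sanovGen_false_inv_mul]
    simp
    omega
  · simp only [SanovCongr, sanovGen_true_mul, sanovGen_true_inv_mul]
    simp
    omega

theorem sanovCongr_sanov (w : FreeGroup Bool) : SanovCongr (sanov w) := by
  have key : ∀ m, SanovCongr m → SanovCongr (sanov w * m) := by
    induction w using FreeGroup.induction_on with
    | C1 => simp
    | of b => exact fun m hm => by simpa [sanov] using (hm.gen_mul b).1
    | inv_of b _ => exact fun m hm => by simpa [sanov] using (hm.gen_mul b).2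
    | mul x y hx hy => exact fun m hm => by rw [map_mul, mul_assoc]; exact hx _ (hy _ hm)
  simpa using key 1 (by simp [SanovCongr])

/-- Euclidean algorithm on the first column `(a, c)`. Here `a` is odd and `c` even, so `|a| ≠ |c|`;
adding or subtracting twice the smaller entry lowers `|a| + |c|` while `c ≠ 0`. At `c = 0` the
determinant and `a ≡ 1 mod 4` give a unipotent matrix with even upper right entry, a power of one
generator. -/
theorem exists_sanov_eq {m : SL(2, ℤ)} (hm : SanovCongr m) : ∃ w, sanov w = m := by
  induction hn : (m.1 0 0).natAbs + (m.1 1 0).natAbs using Nat.strong_induction_on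
    generalizing m with
  | _ n ih =>
    have up (b : Bool) (h : ∃ w, sanov w = sanovGen b * m) : ∃ w, sanov w = m := by
      obtain ⟨w, hw⟩ := h
      exact ⟨(FreeGroup.of b)⁻¹ * w, by rw [map_mul, hw]; simp [sanov]⟩
    have down (b : Bool) (h : ∃ w, sanov w = (sanovGen b)⁻¹ * m) : ∃ w, sanov w = m := by
      obtain ⟨w, hw⟩ := h
      exact ⟨FreeGroup.of b * w, by rw [map_mul, hw]; simp [sanov]⟩
    have hm' := hm
    obtain ⟨h1, h2, h3, h4⟩ := hm'
    by_cases hc : m.1 1 0 = 0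
    · have hd := m.2
      rw [Matrix.det_fin_two, hc, mul_zero, sub_zero] at hd
      have ha : m.1 0 0 = 1 ∧ m.1 1 1 = 1 := by
        rcases Int.eq_one_or_neg_one_of_mul_eq_one' hd with h | h <;> omega
      obtain ⟨t, ht⟩ : ∃ t, m.1 0 1 = 2 * t := ⟨m.1 0 1 / 2, by omega⟩
      have hpow (k : ℕ) : (sanovGen true ^ k).1 = !![1, 2 * (k : ℤ); 0, 1] := by
        induction k with
        | zero => simp [Matrix.one_fin_two]
        | succ k ihk =>
          rw [pow_succ', sanovGen_true_mul, ihk]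
          ext i j
          fin_cases i <;> fin_cases j <;> simp
          ring
      have hz : m = sanovGen true ^ t := by
        rcases Int.eq_nat_or_neg t with ⟨k, rfl | rfl⟩
        · rw [zpow_natCast]
          ext i j
          rw [hpow]
          fin_cases i <;> fin_cases j <;> simp [ha, ht, hc]
        · rw [_root_.zpow_neg, zpow_natCast]
          ext i j
          rw [Matrix.SpecialLinearGroup.coe_inv, hpow, Matrix.adjugate_fin_two]
          fin_cases i <;> fin_cases j <;> simp [ha, ht, hc]
      exact ⟨FreeGroup.of true ^ t, by rw [map_zpow, hz]; simp [sanov]⟩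
    · rcases lt_trichotomy (m.1 0 0).natAbs (m.1 1 0).natAbs with h | h | h
      · rcases lt_or_ge 0 (m.1 0 0 * m.1 1 0) with hs | hs
        · refine down false (ih _ ?_ (hm.gen_mul false).2 rfl)
          rw [sanovGen_false_inv_mul]
          rcases pos_and_pos_or_neg_and_neg_of_mul_pos hs with hs | hs <;> simp <;> omega
        · refine up false (ih _ ?_ (hm.gen_mul false).1 rfl)
          rw [sanovGen_false_mul]
          rcases mul_nonpos_iff.1 hs with hs | hs <;> simp <;> omega
      · omega
      · rcases lt_or_ge 0 (m.1 0 0 * m.1 1 0) with hs | hs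
        · refine down true (ih _ ?_ (hm.gen_mul true).2 rfl)
          rw [sanovGen_true_inv_mul]
          rcases pos_and_pos_or_neg_and_neg_of_mul_pos hs with hs | hs <;> simp <;> omega
        · refine up true (ih _ ?_ (hm.gen_mul true).1 rfl)
          rw [sanovGen_true_mul]
          rcases mul_nonpos_iff.1 hs with hs | hs <;> simp <;> omega

end FlatRat

namespace FlatRat

/-! ### Auxiliary primitive recursive functions and predicates -/

/-- The numbering of `ℤ` sends `n ≥ 0` to `2n` and `-(n+1)` to `2n+1`. The positive and negative
parts can thus be read off from parity, and the ring operations on `ℤ` reduce to arithmetic of these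
parts. -/
theorem primrec_int_toNat : Primrec Int.toNat := by
  have h : Primrec fun z : ℤ => if Encodable.encode z % 2 = 0 then Encodable.encode z / 2 else 0 :=
    Primrec.ite (Primrec.eq.comp (Primrec.nat_mod.comp Primrec.encode (Primrec.const 2))
      (Primrec.const 0)) (Primrec.nat_div.comp Primrec.encode (Primrec.const 2)) (Primrec.const 0)
  refine h.of_eq fun z => ?_
  rcases z with n | n
  · have : Encodable.encode (Int.ofNat n) = 2 * n := rfl
    rw [this]
    simp
  · have : Encodable.encode (Int.negSucc n) = 2 * n + 1 := rfl
    rw [this, if_neg (by omega)]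
    rfl

theorem primrec_int_neg_toNat : Primrec fun z : ℤ => (-z).toNat := by
  have h : Primrec fun z : ℤ =>
      if Encodable.encode z % 2 = 0 then 0 else Encodable.encode z / 2 + 1 :=
    Primrec.ite (Primrec.eq.comp (Primrec.nat_mod.comp Primrec.encode (Primrec.const 2))
      (Primrec.const 0)) (Primrec.const 0)
      (Primrec.nat_add.comp (Primrec.nat_div.comp Primrec.encode (Primrec.const 2))
        (Primrec.const 1))
  refine h.of_eq fun z => ?_
  rcases z with n | n
  · have : Encodable.encode (Int.ofNat n) = 2 * n := rfl
    rw [this, if_pos (by omega)]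
    simp
  · have : Encodable.encode (Int.negSucc n) = 2 * n + 1 := rfl
    rw [this, if_neg (by omega), Int.neg_negSucc]
    simp
    omega

theorem primrec_natCast_sub : Primrec₂ fun a b : ℕ => (a : ℤ) - b := by
  refine Primrec₂.encode_iff.1 ?_
  have h : Primrec₂ fun a b : ℕ => if b ≤ a then 2 * (a - b) else 2 * (b - a - 1) + 1 :=
    Primrec.ite (Primrec.nat_le.comp Primrec.snd Primrec.fst)
      (Primrec.nat_double.comp (Primrec.nat_sub.comp Primrec.fst Primrec.snd))
      (Primrec.nat_double_succ.comp (Primrec.nat_sub.comp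
        (Primrec.nat_sub.comp Primrec.snd Primrec.fst) (Primrec.const 1)))
  refine h.of_eq fun a b => ?_
  split_ifs with hab
  · obtain ⟨c, rfl⟩ := Nat.exists_eq_add_of_le hab
    have h : ((b + c : ℕ) : ℤ) - b = Int.ofNat c := by simp
    rw [h, Nat.add_sub_cancel_left]
    rfl
  · obtain ⟨c, rfl⟩ := Nat.exists_eq_add_of_lt (not_le.1 hab)
    have h : (a : ℤ) - (a + c + 1 : ℕ) = Int.negSucc c := by
      rw [Int.negSucc_eq]; push_cast; ring
    rw [h, show a + c + 1 - a - 1 = c by omega]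
    rfl

theorem primrec_int_add : Primrec₂ fun a b : ℤ => a + b := by
  have h : Primrec₂ fun a b : ℤ =>
      ((a.toNat + b.toNat : ℕ) : ℤ) - (((-a).toNat + (-b).toNat : ℕ) : ℤ) :=
    primrec_natCast_sub.comp
      (Primrec.nat_add.comp (primrec_int_toNat.comp Primrec.fst)
        (primrec_int_toNat.comp Primrec.snd))
      (Primrec.nat_add.comp (primrec_int_neg_toNat.comp Primrec.fst)
        (primrec_int_neg_toNat.comp Primrec.snd))
  refine h.of_eq fun a b => ?_
  omega

theorem primrec_int_neg : Primrec fun a : ℤ => -a := by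
  have h : Primrec fun a : ℤ => ((-a).toNat : ℤ) - (a.toNat : ℤ) :=
    primrec_natCast_sub.comp primrec_int_neg_toNat primrec_int_toNat
  refine h.of_eq fun a => ?_
  omega

theorem primrec_int_sub : Primrec₂ fun a b : ℤ => a - b :=
  (primrec_int_add.comp Primrec.fst (primrec_int_neg.comp Primrec.snd)).of_eq fun p =>
    (sub_eq_add_neg p.1 p.2).symm

theorem primrec_int_natCast : Primrec fun n : ℕ => (n : ℤ) :=
  (primrec_natCast_sub.comp Primrec.id (Primrec.const 0)).of_eq fun n => by simp

theorem primrec_int_natAbs : Primrec Int.natAbs :=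
  (Primrec.nat_add.comp primrec_int_toNat primrec_int_neg_toNat).of_eq fun n => by omega

theorem primrec_int_mul : Primrec₂ fun a b : ℤ => a * b := by
  have h : Primrec₂ fun a b : ℤ =>
      ((a.toNat * b.toNat + (-a).toNat * (-b).toNat : ℕ) : ℤ) -
        ((a.toNat * (-b).toNat + (-a).toNat * b.toNat : ℕ) : ℤ) := by
    have h1 : Primrec fun p : ℤ × ℤ => p.1.toNat := primrec_int_toNat.comp Primrec.fst
    have h2 : Primrec fun p : ℤ × ℤ => p.2.toNat := primrec_int_toNat.comp Primrec.snd
    have h3 : Primrec fun p : ℤ × ℤ => (-p.1).toNat := primrec_int_neg_toNat.comp Primrec.fst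
    have h4 : Primrec fun p : ℤ × ℤ => (-p.2).toNat := primrec_int_neg_toNat.comp Primrec.snd
    exact primrec_natCast_sub.comp
      (Primrec.nat_add.comp (Primrec.nat_mul.comp h1 h2) (Primrec.nat_mul.comp h3 h4))
      (Primrec.nat_add.comp (Primrec.nat_mul.comp h1 h4) (Primrec.nat_mul.comp h3 h2))
  refine h.of_eq fun a b => ?_
  have ha : a = (a.toNat : ℤ) - ((-a).toNat : ℤ) := by omega
  have hb : b = (b.toNat : ℤ) - ((-b).toNat : ℤ) := by omega
  conv_rhs => rw [ha, hb]
  push_cast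
  ring

theorem primrecRel_int_dvd : PrimrecRel fun a b : ℤ => a ∣ b := by
  have h : PrimrecRel fun a b : ℤ => b.natAbs % a.natAbs = 0 :=
    Primrec.eq.comp (Primrec.nat_mod.comp (primrec_int_natAbs.comp Primrec.snd)
      (primrec_int_natAbs.comp Primrec.fst)) (Primrec.const 0)
  refine h.of_eq fun a b => ?_
  rw [← Int.natAbs_dvd_natAbs, Nat.dvd_iff_mod_eq_zero]

section Quantifiers

variable {β γ : Type*} [Primcodable β] [Primcodable γ]

theorem primrecPred_exists_mem {L : β → List γ} {P : β → γ → Prop} (hL : Primrec L)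
    (hP : PrimrecPred fun x : β × γ => P x.1 x.2) : PrimrecPred fun b => ∃ a ∈ L b, P b a := by
  have h : PrimrecRel fun (a : γ) (b : β) => P b a :=
    (hP.comp (Primrec.pair Primrec.snd Primrec.fst) : PrimrecPred fun x : γ × β => P x.2 x.1)
  exact h.exists_mem_list.comp hL Primrec.id

theorem primrecPred_forall_mem {L : β → List γ} {P : β → γ → Prop} (hL : Primrec L)
    (hP : PrimrecPred fun x : β × γ => P x.1 x.2) : PrimrecPred fun b => ∀ a ∈ L b, P b a := by
  have h : PrimrecRel fun (a : γ) (b : β) => P b a :=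
    (hP.comp (Primrec.pair Primrec.snd Primrec.fst) : PrimrecPred fun x : γ × β => P x.2 x.1)
  exact h.forall_mem_list.comp hL Primrec.id

theorem primrecPred_mem {L : β → List γ} {f : β → γ} (hL : Primrec L) (hf : Primrec f) :
    PrimrecPred fun b => f b ∈ L b := by
  classical
  refine (primrecPred_exists_mem (P := fun b a => a = f b) hL
    (Primrec.eq.comp Primrec.snd (hf.comp Primrec.fst))).of_eq fun b => ?_
  simp

theorem primrecPred_imp {p q : β → Prop} (hp : PrimrecPred p) (hq : PrimrecPred q) :
    PrimrecPred fun b => p b → q b :=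
  (hp.not.or hq).of_eq fun _ => imp_iff_not_or.symm

end Quantifiers

/-- Unbounded search for a witness of one of two primitive recursive relations, one of which always
has a witness. -/
theorem exists_computable_search {α : Type*} [Primcodable α] {p q : α → ℕ → Prop}
    (hp : PrimrecRel p) (hq : PrimrecRel q) (h : ∀ a, ∃ n, p a n ∨ q a n) :
    ∃ f : α → Bool, Computable f ∧ ∀ a, ∃ n, (f a = true ∧ p a n) ∨ (f a = false ∧ q a n) := by
  classical
  let G : α → ℕ → Option Bool := fun a n =>
    if p a n then some true else if q a n then some false else none
  have hG : Primrec₂ G :=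
    Primrec.ite hp (Primrec.const _) (Primrec.ite hq (Primrec.const _) (Primrec.const _))
  have hdom : ∀ a, (Nat.rfindOpt (G a)).Dom := by
    intro a
    rw [Nat.rfindOpt_dom]
    obtain ⟨n, hn⟩ := h a
    by_cases h1 : p a n
    · exact ⟨n, true, by simp [G, h1]⟩
    · exact ⟨n, false, by simp [G, h1, hn.resolve_left h1]⟩
  refine ⟨fun a => (Nat.rfindOpt (G a)).get (hdom a), ?_, fun a => ?_⟩
  · have := Partrec.rfindOpt hG.to_comp
    exact this.of_eq fun a => (Part.some_get (hdom a)).symm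
  · obtain ⟨n, hn⟩ := Nat.rfindOpt_spec (Part.get_mem (hdom a))
    refine ⟨n, ?_⟩
    beta_reduce
    generalize (Nat.rfindOpt (G a)).get (hdom a) = b at hn ⊢
    simp only [G] at hn
    split_ifs at hn with h1 h2
    · simp_all
    · simp_all
    · simp at hn

end FlatRat

namespace FlatRat

/-! ### Matrices with a common denominator -/

/-- Integer `2 × 2` matrices, by rows. -/
abbrev IMat : Type := (ℤ × ℤ) × (ℤ × ℤ)

/-- Rational `2 × 2` matrices, given by an integer matrix and a common denominator. -/
abbrev QMat : Type := IMat × ℕ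

/-- The identity matrix. -/
def ione : IMat := ((1, 0), (0, 1))

/-- The product of integer matrices. -/
def imul (x y : IMat) : IMat :=
  ((x.1.1 * y.1.1 + x.1.2 * y.2.1, x.1.1 * y.1.2 + x.1.2 * y.2.2),
    (x.2.1 * y.1.1 + x.2.2 * y.2.1, x.2.1 * y.1.2 + x.2.2 * y.2.2))

/-- Scalar multiples of integer matrices. -/
def ismul (n : ℤ) (x : IMat) : IMat := ((n * x.1.1, n * x.1.2), (n * x.2.1, n * x.2.2))

/-- The determinant of an integer matrix. -/
def idet (x : IMat) : ℤ := x.1.1 * x.2.2 - x.1.2 * x.2.1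

/-- The adjugate of an integer matrix. -/
def iadj (x : IMat) : IMat := ((x.2.2, -x.1.2), (-x.2.1, x.1.1))

/-- The identity matrix, with denominator `1`. -/
def qone : QMat := (ione, 1)

/-- The product of rational matrices. -/
def qmul (k l : QMat) : QMat := (imul k.1 l.1, k.2 * l.2)

/-- The product of an integer matrix and a rational matrix. -/
def qlmul (x : IMat) (k : QMat) : QMat := (imul x k.1, k.2)

/-- Equality of the rational matrices described by two codes with nonzero denominators. -/
def QEq (k l : QMat) : Prop := ismul l.2 k.1 = ismul k.2 l.1

/-- The absolute value of the determinant of `k` exceeds that of `g`. -/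
def Exceeds (k g : QMat) : Prop :=
  (idet g.1).natAbs * (k.2 * k.2) < (idet k.1).natAbs * (g.2 * g.2)

/-- The matrix belongs to `P(2,ℚ)`, and is given with denominator `1` if it is in `GL(2,ℤ)`. -/
def Admissible (k : QMat) : Prop :=
  k.2 ≠ 0 ∧ (k.2 * k.2 < (idet k.1).natAbs ∨ (k.2 = 1 ∧ (idet k.1).natAbs = 1))

/-- The integer multiple of `g k⁻¹` by `sanovQuotDen k g`. -/
def sanovQuotNum (k g : QMat) : IMat := ismul k.2 (imul g.1 (iadj k.1))

/-- A common denominator of `g k⁻¹`. -/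
def sanovQuotDen (k g : QMat) : ℤ := g.2 * idet k.1

/-- The matrix `g k⁻¹` belongs to the Sanov subgroup. -/
def SanovEquiv (k g : QMat) : Prop :=
  4 * sanovQuotDen k g ∣ (sanovQuotNum k g).1.1 - sanovQuotDen k g ∧
  2 * sanovQuotDen k g ∣ (sanovQuotNum k g).1.2 ∧
  2 * sanovQuotDen k g ∣ (sanovQuotNum k g).2.1 ∧
  sanovQuotDen k g ∣ (sanovQuotNum k g).2.2 ∧
  idet (sanovQuotNum k g) = sanovQuotDen k g * sanovQuotDen k g

/-- The Sanov generators and their inverses. -/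
def sanovGens : List IMat :=
  [((1, 2), (0, 1)), ((1, -2), (0, 1)), ((1, 0), (2, 1)), ((1, 0), (-2, 1))]

/-- The ball of radius `n` in the Sanov subgroup. -/
def sanovBall : ℕ → List IMat
  | 0 => [ione]
  | n + 1 => sanovBall n ++ (sanovBall n).flatMap fun m => sanovGens.map fun s => imul s m

/-- The matrix described by its entries, with a common denominator. -/
def commonDen (a : MatCode) : QMat :=
  (((a.1.1.1 * (a.1.2.2 * a.2.1.2 * a.2.2.2 : ℕ), a.1.2.1 * (a.1.1.2 * a.2.1.2 * a.2.2.2 : ℕ)),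
    (a.2.1.1 * (a.1.1.2 * a.1.2.2 * a.2.2.2 : ℕ), a.2.2.1 * (a.1.1.2 * a.1.2.2 * a.2.1.2 : ℕ))),
    a.1.1.2 * a.1.2.2 * a.2.1.2 * a.2.2.2)

/-- The multiple of a matrix by its common denominator. -/
def clearDen (a : MatCode) : MatCode :=
  ((((commonDen a).1.1.1, 1), ((commonDen a).1.1.2, 1)),
    (((commonDen a).1.2.1, 1), ((commonDen a).1.2.2, 1)))

/-! ### Unfolding of expressions -/

/-- A list of expressions stands for their product. -/
abbrev Stack : Type := List (RegularExpression MatCode)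

/-- One step of unfolding of `E · r`: a matrix which is split off and the remaining product. -/
def unfoldHead : RegularExpression MatCode → Stack → List (QMat × Stack)
  | .zero, _ => []
  | .epsilon, r => [(qone, r)]
  | .char a, r => [(commonDen a, r)]
  | .plus E F, r => [(qone, E :: r), (qone, F :: r)]
  | .comp E F, r => [(qone, E :: F :: r)]
  | .star E, r => [(qone, r), (qone, E :: .star E :: r)]

/-- One step of unfolding of a product of expressions. -/
def next : Stack → List (QMat × Stack)
  | [] => []
  | E :: r => unfoldHead E r

/-- A state of the unfolding: a remaining product, and the product of the matrices split off. -/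
abbrev Node : Type := Stack × QMat

/-- Edges between nodes, labelled with integer matrices. -/
abbrev Edge : Type := Node × (IMat × Node)

/-- The nodes reached after `n` steps. -/
def reachAt (s : Stack) : ℕ → List Node
  | 0 => [(s, qone)]
  | n + 1 => (reachAt s n).flatMap fun u => (next u.1).map fun t => (t.2, qmul u.2 t.1)

/-- The matrix `g` is reached after `n` steps. -/
def HitAt (s : Stack) (g : QMat) (n : ℕ) : Prop := ∃ u ∈ reachAt s n, u.1 = [] ∧ QEq u.2 g

/-- A matrix outside of `P(2,ℚ)` occurs after `n` steps. -/
def BadAt (s : Stack) (n : ℕ) : Prop := ∃ u ∈ reachAt s n, ∃ t ∈ next u.1, ¬Admissible t.1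

/-! ### Finite graphs as proofs of nonmembership -/

/-- Certificates for nonmembership: a radius, a list of nodes and a list of edges. -/
abbrev Cert : Type := ℕ × (List Node × List Edge)

/-- Every step from a node of the certificate follows an edge of the certificate, or leads to a
determinant that is too large. -/
def Cert.StepClosed (g : QMat) (c : Cert) : Prop :=
  ∀ u ∈ c.2.1, ∀ t ∈ next u.1, Exceeds (qmul u.2 t.1) g ∨
    ∃ v ∈ c.2.1, (v.1 = t.2 ∧ v.2.2 ≠ 0) ∧
      ∃ x ∈ sanovBall c.1, (u, (x, v)) ∈ c.2.2 ∧ QEq (qmul u.2 t.1) (qlmul x v.2)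

/-- The edges are closed under those compositions which stay in the ball. -/
def Cert.CompClosed (c : Cert) : Prop :=
  ∀ e ∈ c.2.2, ∀ f ∈ c.2.2, e.2.2 = f.1 → imul e.2.1 f.2.1 ∈ sanovBall c.1 →
    (e.1, (imul e.2.1 f.2.1, f.2.2)) ∈ c.2.2

/-- No final node yields the matrix `g`. -/
def Cert.Avoids (s : Stack) (g : QMat) (c : Cert) : Prop :=
  ∀ u ∈ c.2.1, u.1 = [] → (¬SanovEquiv u.2 g ∨
    ∃ x ∈ sanovBall c.1, QEq (qlmul x u.2) g ∧ ¬((s, qone), (x, u)) ∈ c.2.2)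

/-- The certificate shows that `g` does not belong to the set described by `s`. -/
def Cert.Refutes (s : Stack) (g : QMat) (c : Cert) : Prop :=
  ((s, qone) ∈ c.2.1 ∧ ∀ u ∈ c.2.1, (u, (ione, u)) ∈ c.2.2) ∧
    c.StepClosed g ∧ c.CompClosed ∧ c.Avoids s g

/-! ### Reduction of a flat term to a product of rational expressions -/

/-- The terms of flat expressions. -/
abbrev Term : Type :=
  RegularExpression MatCode × List (MatCode × RegularExpression MatCode)

/-- The product of the expressions in a term, after multiplication of the matrices `g_i` by common
denominators. -/
def termStack (T : Term) : Stack :=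
  T.1 :: T.2.flatMap fun p => [RegularExpression.char (clearDen p.1), p.2]

/-- The product of the common denominators of the matrices `g_i` in a term. -/
def termDen (T : Term) : ℕ := T.2.foldr (fun p n => (commonDen p.1).2 * n) 1

/-- The matrix whose membership in the product of `termStack T` is to be tested. -/
def termTarget (g : MatCode) (T : Term) : QMat :=
  (ismul (termDen T) (commonDen g).1, (commonDen g).2)

/-! ### Primitive recursiveness -/

section Primrec

variable {α : Type*} [Primcodable α]

theorem primrec_imul {f g : α → IMat} (hf : Primrec f) (hg : Primrec g) :
    Primrec fun a => imul (f a) (g a) := by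
  have f1 := Primrec.fst.comp (Primrec.fst.comp hf)
  have f2 := Primrec.snd.comp (Primrec.fst.comp hf)
  have f3 := Primrec.fst.comp (Primrec.snd.comp hf)
  have f4 := Primrec.snd.comp (Primrec.snd.comp hf)
  have g1 := Primrec.fst.comp (Primrec.fst.comp hg)
  have g2 := Primrec.snd.comp (Primrec.fst.comp hg)
  have g3 := Primrec.fst.comp (Primrec.snd.comp hg)
  have g4 := Primrec.snd.comp (Primrec.snd.comp hg)
  exact Primrec.pair
    (Primrec.pair
      (primrec_int_add.comp (primrec_int_mul.comp f1 g1) (primrec_int_mul.comp f2 g3))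
      (primrec_int_add.comp (primrec_int_mul.comp f1 g2) (primrec_int_mul.comp f2 g4)))
    (Primrec.pair
      (primrec_int_add.comp (primrec_int_mul.comp f3 g1) (primrec_int_mul.comp f4 g3))
      (primrec_int_add.comp (primrec_int_mul.comp f3 g2) (primrec_int_mul.comp f4 g4)))

theorem primrec_ismul {n : α → ℤ} {f : α → IMat} (hn : Primrec n) (hf : Primrec f) :
    Primrec fun a => ismul (n a) (f a) :=
  Primrec.pair
    (Primrec.pair (primrec_int_mul.comp hn (Primrec.fst.comp (Primrec.fst.comp hf)))
      (primrec_int_mul.comp hn (Primrec.snd.comp (Primrec.fst.comp hf))))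
    (Primrec.pair (primrec_int_mul.comp hn (Primrec.fst.comp (Primrec.snd.comp hf)))
      (primrec_int_mul.comp hn (Primrec.snd.comp (Primrec.snd.comp hf))))

theorem primrec_idet : Primrec idet := by
  have f1 := Primrec.fst.comp (Primrec.fst (α := ℤ × ℤ) (β := ℤ × ℤ))
  have f2 := Primrec.snd.comp (Primrec.fst (α := ℤ × ℤ) (β := ℤ × ℤ))
  have f3 := Primrec.fst.comp (Primrec.snd (α := ℤ × ℤ) (β := ℤ × ℤ))
  have f4 := Primrec.snd.comp (Primrec.snd (α := ℤ × ℤ) (β := ℤ × ℤ))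
  exact primrec_int_sub.comp (primrec_int_mul.comp f1 f4) (primrec_int_mul.comp f2 f3)

theorem primrec_iadj : Primrec iadj := by
  have f1 := Primrec.fst.comp (Primrec.fst (α := ℤ × ℤ) (β := ℤ × ℤ))
  have f2 := Primrec.snd.comp (Primrec.fst (α := ℤ × ℤ) (β := ℤ × ℤ))
  have f3 := Primrec.fst.comp (Primrec.snd (α := ℤ × ℤ) (β := ℤ × ℤ))
  have f4 := Primrec.snd.comp (Primrec.snd (α := ℤ × ℤ) (β := ℤ × ℤ))
  exact Primrec.pair (Primrec.pair f4 (primrec_int_neg.comp f2))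
    (Primrec.pair (primrec_int_neg.comp f3) f1)

theorem primrec_qmul {f g : α → QMat} (hf : Primrec f) (hg : Primrec g) :
    Primrec fun a => qmul (f a) (g a) :=
  Primrec.pair (primrec_imul (Primrec.fst.comp hf) (Primrec.fst.comp hg))
    (Primrec.nat_mul.comp (Primrec.snd.comp hf) (Primrec.snd.comp hg))

theorem primrec_qlmul {f : α → IMat} {g : α → QMat} (hf : Primrec f) (hg : Primrec g) :
    Primrec fun a => qlmul (f a) (g a) :=
  Primrec.pair (primrec_imul hf (Primrec.fst.comp hg)) (Primrec.snd.comp hg)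

theorem primrecPred_qEq {f g : α → QMat} (hf : Primrec f) (hg : Primrec g) :
    PrimrecPred fun a => QEq (f a) (g a) :=
  Primrec.eq.comp
    (primrec_ismul (primrec_int_natCast.comp (Primrec.snd.comp hg)) (Primrec.fst.comp hf))
    (primrec_ismul (primrec_int_natCast.comp (Primrec.snd.comp hf)) (Primrec.fst.comp hg))

theorem primrecPred_exceeds {f g : α → QMat} (hf : Primrec f) (hg : Primrec g) :
    PrimrecPred fun a => Exceeds (f a) (g a) := by
  have hd {k : α → QMat} (hk : Primrec k) : Primrec fun a => (idet (k a).1).natAbs :=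
    primrec_int_natAbs.comp (primrec_idet.comp (Primrec.fst.comp hk))
  have hs {k : α → QMat} (hk : Primrec k) : Primrec fun a => (k a).2 * (k a).2 :=
    Primrec.nat_mul.comp (Primrec.snd.comp hk) (Primrec.snd.comp hk)
  exact Primrec.nat_lt.comp (Primrec.nat_mul.comp (hd hg) (hs hf))
    (Primrec.nat_mul.comp (hd hf) (hs hg))

theorem primrecPred_admissible : PrimrecPred Admissible := by
  have hd : Primrec fun k : QMat => (idet k.1).natAbs :=
    primrec_int_natAbs.comp (primrec_idet.comp Primrec.fst)
  have h2 : Primrec fun k : QMat => k.2 := Primrec.snd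
  exact (Primrec.eq.comp h2 (Primrec.const 0)).not.and
    ((Primrec.nat_lt.comp (Primrec.nat_mul.comp h2 h2) hd).or
      ((Primrec.eq.comp h2 (Primrec.const 1)).and (Primrec.eq.comp hd (Primrec.const 1))))

theorem primrecPred_sanovEquiv {f g : α → QMat} (hf : Primrec f) (hg : Primrec g) :
    PrimrecPred fun a => SanovEquiv (f a) (g a) := by
  have hn : Primrec fun a => sanovQuotNum (f a) (g a) :=
    primrec_ismul (primrec_int_natCast.comp (Primrec.snd.comp hf))
      (primrec_imul (Primrec.fst.comp hg) (primrec_iadj.comp (Primrec.fst.comp hf)))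
  have hm : Primrec fun a => sanovQuotDen (f a) (g a) :=
    primrec_int_mul.comp (primrec_int_natCast.comp (Primrec.snd.comp hg))
      (primrec_idet.comp (Primrec.fst.comp hf))
  have hc (z : ℤ) : Primrec fun a => z * sanovQuotDen (f a) (g a) :=
    primrec_int_mul.comp (Primrec.const z) hm
  exact (primrecRel_int_dvd.comp (hc 4)
      (primrec_int_sub.comp (Primrec.fst.comp (Primrec.fst.comp hn)) hm)).and <|
    (primrecRel_int_dvd.comp (hc 2) (Primrec.snd.comp (Primrec.fst.comp hn))).and <|
    (primrecRel_int_dvd.comp (hc 2) (Primrec.fst.comp (Primrec.snd.comp hn))).and <|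
    (primrecRel_int_dvd.comp hm (Primrec.snd.comp (Primrec.snd.comp hn))).and <|
    Primrec.eq.comp (primrec_idet.comp hn) (primrec_int_mul.comp hm hm)

theorem primrec_sanovBall : Primrec sanovBall := by
  have h : Primrec₂ fun (_ : ℕ) (l : List IMat) =>
      l ++ l.flatMap fun m => sanovGens.map fun s => imul s m :=
    Primrec.list_append.comp Primrec.snd (Primrec.list_flatMap Primrec.snd
      (Primrec.list_map (Primrec.const _)
        (primrec_imul Primrec.snd (Primrec.snd.comp Primrec.fst))))
  refine (Primrec.nat_rec₁ [ione] h).of_eq fun n => ?_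
  induction n with
  | zero => rfl
  | succ n ih => simp only [sanovBall, ← ih]

theorem primrec_commonDen : Primrec commonDen := by
  have a1 : Primrec fun a : MatCode => a.1.1 := Primrec.fst.comp Primrec.fst
  have a2 : Primrec fun a : MatCode => a.1.2 := Primrec.snd.comp Primrec.fst
  have a3 : Primrec fun a : MatCode => a.2.1 := Primrec.fst.comp Primrec.snd
  have a4 : Primrec fun a : MatCode => a.2.2 := Primrec.snd.comp Primrec.snd
  have entry {n : MatCode → ℤ} {d₁ d₂ d₃ : MatCode → ℕ} (hn : Primrec n) (h₁ : Primrec d₁)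
      (h₂ : Primrec d₂) (h₃ : Primrec d₃) :
      Primrec fun a => n a * (d₁ a * d₂ a * d₃ a : ℕ) :=
    primrec_int_mul.comp hn (primrec_int_natCast.comp
      (Primrec.nat_mul.comp (Primrec.nat_mul.comp h₁ h₂) h₃))
  have d1 := Primrec.snd.comp a1
  have d2 := Primrec.snd.comp a2
  have d3 := Primrec.snd.comp a3
  have d4 := Primrec.snd.comp a4
  exact Primrec.pair
    (Primrec.pair
      (Primrec.pair (entry (Primrec.fst.comp a1) d2 d3 d4) (entry (Primrec.fst.comp a2) d1 d3 d4))
      (Primrec.pair (entry (Primrec.fst.comp a3) d1 d2 d4) (entry (Primrec.fst.comp a4) d1 d2 d3)))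
    (Primrec.nat_mul.comp (Primrec.nat_mul.comp (Primrec.nat_mul.comp d1 d2) d3) d4)

theorem primrec_clearDen : Primrec clearDen := by
  have h : Primrec fun a => (commonDen a).1 := Primrec.fst.comp primrec_commonDen
  have entry {n : MatCode → ℤ} (hn : Primrec n) : Primrec fun a => (n a, (1 : ℕ)) :=
    Primrec.pair hn (Primrec.const 1)
  exact Primrec.pair
    (Primrec.pair (entry (Primrec.fst.comp (Primrec.fst.comp h)))
      (entry (Primrec.snd.comp (Primrec.fst.comp h))))
    (Primrec.pair (entry (Primrec.fst.comp (Primrec.snd.comp h)))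
      (entry (Primrec.snd.comp (Primrec.snd.comp h))))

theorem primrec_char : Primrec (RegularExpression.char : MatCode → RegularExpression MatCode) :=
  Primrec.encode_iff.1 <|
    (Primrec.nat_add.comp (Primrec.nat_mul.comp (Primrec.const 4) Primrec.encode)
      (Primrec.const 2) : Primrec fun a : MatCode => 4 * Encodable.encode a + 2)

/-- Unfolding of an expression in terms of its number. -/
def unfoldNum (n : ℕ) (r : Stack) : List (QMat × Stack) :=
  if n = 0 then []
  else if n = 1 then [(qone, r)]
  else if (n - 2) % 4 = 0 then [(commonDen (Denumerable.ofNat MatCode ((n - 2) / 4)), r)]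
  else if (n - 2) % 4 = 1 then
    [(qone, Denumerable.ofNat (RegularExpression MatCode) ((n - 2) / 4).unpair.1 :: r),
      (qone, Denumerable.ofNat (RegularExpression MatCode) ((n - 2) / 4).unpair.2 :: r)]
  else if (n - 2) % 4 = 2 then
    [(qone, Denumerable.ofNat (RegularExpression MatCode) ((n - 2) / 4).unpair.1 ::
      Denumerable.ofNat (RegularExpression MatCode) ((n - 2) / 4).unpair.2 :: r)]
  else [(qone, r), (qone, Denumerable.ofNat (RegularExpression MatCode) ((n - 2) / 4) ::
    Denumerable.ofNat (RegularExpression MatCode) n :: r)]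

/-- A step of unfolding inspects only the outermost constructor, which is visible in the number of
the expression through its residue modulo 4. So no recursion over expressions is needed to see that
unfolding is primitive recursive. -/
theorem unfoldNum_encode (E : RegularExpression MatCode) (r : Stack) :
    unfoldNum (Encodable.encode E) r = unfoldHead E r := by
  have hE (F : RegularExpression MatCode) : Encodable.encode F = encodeRegex F := rfl
  have hof (F : RegularExpression MatCode) :
      Denumerable.ofNat (RegularExpression MatCode) (encodeRegex F) = F :=
    Denumerable.ofNat_encode F
  rw [unfoldNum]
  cases E with
  | zero => rfl
  | epsilon => rfl
  | char a =>
    have h : (4 * Encodable.encode a + 2 - 2) / 4 = Encodable.encode a := by omega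
    rw [hE, encodeRegex, if_neg (by omega), if_neg (by omega), if_pos (by omega), h,
      Denumerable.ofNat_encode, unfoldHead]
  | plus E F =>
    have h (k : ℕ) : (4 * k + 3 - 2) / 4 = k := by omega
    rw [hE, encodeRegex, if_neg (by omega), if_neg (by omega), if_neg (by omega),
      if_pos (by omega), h, Nat.unpair_pair, hof, hof, unfoldHead]
  | comp E F =>
    have h (k : ℕ) : (4 * k + 4 - 2) / 4 = k := by omega
    rw [hE, encodeRegex, if_neg (by omega), if_neg (by omega), if_neg (by omega),
      if_neg (by omega), if_pos (by omega), h, Nat.unpair_pair, hof, hof, unfoldHead]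
  | star E =>
    have h (k : ℕ) : (4 * k + 5 - 2) / 4 = k := by omega
    rw [hE, hof, encodeRegex, if_neg (by omega), if_neg (by omega), if_neg (by omega),
      if_neg (by omega), if_neg (by omega), h, hof, unfoldHead]

theorem primrec_unfoldNum : Primrec₂ unfoldNum := by
  have hn : Primrec fun p : ℕ × Stack => p.1 := Primrec.fst
  have hr : Primrec fun p : ℕ × Stack => p.2 := Primrec.snd
  have hm := Primrec.nat_sub.comp hn (Primrec.const 2)
  have hq := Primrec.nat_div.comp hm (Primrec.const 4)
  have hmod := Primrec.nat_mod.comp hm (Primrec.const 4)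
  have h1 := Primrec.fst.comp (Primrec.unpair.comp hq)
  have h2 := Primrec.snd.comp (Primrec.unpair.comp hq)
  have ofN {f : ℕ × Stack → ℕ} (hf : Primrec f) :
      Primrec fun p => Denumerable.ofNat (RegularExpression MatCode) (f p) :=
    (Primrec.ofNat _).comp hf
  have item {f : ℕ × Stack → Stack} (hf : Primrec f) : Primrec fun p => (qone, f p) :=
    Primrec.pair (Primrec.const qone) hf
  have single {f : ℕ × Stack → QMat × Stack} (hf : Primrec f) : Primrec fun p => [f p] :=
    Primrec.list_cons.comp hf (Primrec.const [])
  refine Primrec.ite (Primrec.eq.comp hn (Primrec.const 0)) (Primrec.const []) ?_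
  refine Primrec.ite (Primrec.eq.comp hn (Primrec.const 1)) (single (item hr)) ?_
  refine Primrec.ite (Primrec.eq.comp hmod (Primrec.const 0))
    (single (Primrec.pair (primrec_commonDen.comp ((Primrec.ofNat _).comp hq)) hr)) ?_
  refine Primrec.ite (Primrec.eq.comp hmod (Primrec.const 1))
    (Primrec.list_cons.comp (item (Primrec.list_cons.comp (ofN h1) hr))
      (single (item (Primrec.list_cons.comp (ofN h2) hr)))) ?_
  exact Primrec.ite (Primrec.eq.comp hmod (Primrec.const 2))
    (single (item (Primrec.list_cons.comp (ofN h1) (Primrec.list_cons.comp (ofN h2) hr))))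
    (Primrec.list_cons.comp (item hr) (single (item (Primrec.list_cons.comp (ofN hq)
      (Primrec.list_cons.comp (ofN hn) hr)))))

theorem primrec_next : Primrec next := by
  have h : Primrec fun s : Stack => List.casesOn (motive := fun _ => List (QMat × Stack)) s []
      (fun E r => unfoldNum (Encodable.encode E) r) :=
    Primrec.list_casesOn (h := fun _ p => unfoldNum (Encodable.encode p.1) p.2) Primrec.id
      (Primrec.const [])
      (primrec_unfoldNum.comp (Primrec.encode.comp (Primrec.fst.comp Primrec.snd))
        (Primrec.snd.comp Primrec.snd))
  refine h.of_eq fun s => ?_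
  cases s with
  | nil => rfl
  | cons E r => exact unfoldNum_encode E r

theorem primrec_reachAt : Primrec₂ reachAt := by
  have h : Primrec₂ fun (_ : Stack) (p : ℕ × List Node) =>
      p.2.flatMap fun u => (next u.1).map fun t => (t.2, qmul u.2 t.1) := by
    refine Primrec.list_flatMap (Primrec.snd.comp Primrec.snd) (Primrec.list_map
      (primrec_next.comp (Primrec.fst.comp Primrec.snd)) ?_)
    exact Primrec.pair (Primrec.snd.comp Primrec.snd)
      (primrec_qmul (Primrec.snd.comp (Primrec.snd.comp Primrec.fst))
        (Primrec.fst.comp Primrec.snd))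
  have h0 : Primrec fun s : Stack => [((s, qone) : Node)] :=
    Primrec.list_cons.comp (Primrec.pair Primrec.id (Primrec.const _)) (Primrec.const [])
  refine (Primrec.nat_rec h0 h).of_eq fun s n => ?_
  induction n with
  | zero => rfl
  | succ n ih => simp only [reachAt, ← ih]

theorem primrecPred_hitAt {s : α → Stack} {g : α → QMat} {n : α → ℕ} (hs : Primrec s)
    (hg : Primrec g) (hn : Primrec n) : PrimrecPred fun a => HitAt (s a) (g a) (n a) :=
  primrecPred_exists_mem (P := fun a (u : Node) => u.1 = [] ∧ QEq u.2 (g a))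
    (primrec_reachAt.comp hs hn)
    ((Primrec.eq.comp (Primrec.fst.comp Primrec.snd) (Primrec.const [])).and
      (primrecPred_qEq (Primrec.snd.comp Primrec.snd) (hg.comp Primrec.fst)))

theorem primrecPred_badAt {s : α → Stack} {n : α → ℕ} (hs : Primrec s) (hn : Primrec n) :
    PrimrecPred fun a => BadAt (s a) (n a) :=
  primrecPred_exists_mem (P := fun _ (u : Node) => ∃ t ∈ next u.1, ¬Admissible t.1)
    (primrec_reachAt.comp hs hn)
    (primrecPred_exists_mem (P := fun _ (t : QMat × Stack) => ¬Admissible t.1)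
      (primrec_next.comp (Primrec.fst.comp Primrec.snd))
      (primrecPred_admissible.comp (Primrec.fst.comp Primrec.snd)).not)

theorem primrecPred_stepClosed {g : α → QMat} {c : α → Cert} (hg : Primrec g) (hc : Primrec c) :
    PrimrecPred fun a => (c a).StepClosed (g a) := by
  have hV : Primrec fun a => (c a).2.1 := Primrec.fst.comp (Primrec.snd.comp hc)
  have hE : Primrec fun a => (c a).2.2 := Primrec.snd.comp (Primrec.snd.comp hc)
  have hB : Primrec fun a => sanovBall (c a).1 := primrec_sanovBall.comp (Primrec.fst.comp hc)
  refine primrecPred_forall_mem (P := fun a (u : Node) => ∀ t ∈ next u.1,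
    Exceeds (qmul u.2 t.1) (g a) ∨ ∃ v ∈ (c a).2.1, (v.1 = t.2 ∧ v.2.2 ≠ 0) ∧
      ∃ x ∈ sanovBall (c a).1, (u, (x, v)) ∈ (c a).2.2 ∧
        QEq (qmul u.2 t.1) (qlmul x v.2)) hV ?_
  refine primrecPred_forall_mem (P := fun (p : α × Node) (t : QMat × Stack) =>
    Exceeds (qmul p.2.2 t.1) (g p.1) ∨ ∃ v ∈ (c p.1).2.1, (v.1 = t.2 ∧ v.2.2 ≠ 0) ∧
      ∃ x ∈ sanovBall (c p.1).1, (p.2, (x, v)) ∈ (c p.1).2.2 ∧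
        QEq (qmul p.2.2 t.1) (qlmul x v.2)) (primrec_next.comp (Primrec.fst.comp Primrec.snd)) ?_
  have hk : Primrec fun p : (α × Node) × (QMat × Stack) => qmul p.1.2.2 p.2.1 :=
    primrec_qmul (Primrec.snd.comp (Primrec.snd.comp Primrec.fst)) (Primrec.fst.comp Primrec.snd)
  have ha : Primrec fun p : (α × Node) × (QMat × Stack) => p.1.1 := Primrec.fst.comp Primrec.fst
  refine (primrecPred_exceeds hk (hg.comp ha)).or ?_
  refine primrecPred_exists_mem (P := fun (p : (α × Node) × (QMat × Stack)) (v : Node) =>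
    (v.1 = p.2.2 ∧ v.2.2 ≠ 0) ∧ ∃ x ∈ sanovBall (c p.1.1).1,
      (p.1.2, (x, v)) ∈ (c p.1.1).2.2 ∧ QEq (qmul p.1.2.2 p.2.1) (qlmul x v.2)) (hV.comp ha) ?_
  refine ((Primrec.eq.comp (Primrec.fst.comp Primrec.snd)
    (Primrec.snd.comp (Primrec.snd.comp Primrec.fst))).and
    (Primrec.eq.comp (Primrec.snd.comp (Primrec.snd.comp Primrec.snd)) (Primrec.const 0)).not).and
    ?_
  refine primrecPred_exists_mem
    (P := fun (p : ((α × Node) × (QMat × Stack)) × Node) (x : IMat) =>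
      (p.1.1.2, (x, p.2)) ∈ (c p.1.1.1).2.2 ∧ QEq (qmul p.1.1.2.2 p.1.2.1) (qlmul x p.2.2))
    (hB.comp (ha.comp Primrec.fst)) ?_
  have hv : Primrec fun p : (((α × Node) × (QMat × Stack)) × Node) × IMat => p.1.2 :=
    Primrec.snd.comp Primrec.fst
  exact (primrecPred_mem (hE.comp (ha.comp (Primrec.fst.comp Primrec.fst)))
    (Primrec.pair (Primrec.snd.comp (Primrec.fst.comp (Primrec.fst.comp Primrec.fst)))
      (Primrec.pair Primrec.snd hv))).and
    (primrecPred_qEq (hk.comp (Primrec.fst.comp Primrec.fst))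
      (primrec_qlmul Primrec.snd (Primrec.snd.comp hv)))

set_option synthInstance.maxSize 1000 in
theorem primrecPred_compClosed {c : α → Cert} (hc : Primrec c) :
    PrimrecPred fun a => (c a).CompClosed := by
  have hE : Primrec fun a => (c a).2.2 := Primrec.snd.comp (Primrec.snd.comp hc)
  have hB : Primrec fun a => sanovBall (c a).1 := primrec_sanovBall.comp (Primrec.fst.comp hc)
  refine primrecPred_forall_mem (P := fun a (e : Edge) => ∀ f ∈ (c a).2.2, e.2.2 = f.1 →
    imul e.2.1 f.2.1 ∈ sanovBall (c a).1 → (e.1, (imul e.2.1 f.2.1, f.2.2)) ∈ (c a).2.2) hE ?_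
  refine primrecPred_forall_mem (P := fun (p : α × Edge) (f : Edge) => p.2.2.2 = f.1 →
    imul p.2.2.1 f.2.1 ∈ sanovBall (c p.1).1 →
      (p.2.1, (imul p.2.2.1 f.2.1, f.2.2)) ∈ (c p.1).2.2) (hE.comp Primrec.fst) ?_
  have ha : Primrec fun p : (α × Edge) × Edge => p.1.1 := Primrec.fst.comp Primrec.fst
  have he : Primrec fun p : (α × Edge) × Edge => p.1.2 := Primrec.snd.comp Primrec.fst
  have hf : Primrec fun p : (α × Edge) × Edge => p.2 := Primrec.snd
  have hm : Primrec fun p : (α × Edge) × Edge => imul p.1.2.2.1 p.2.2.1 :=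
    primrec_imul (Primrec.fst.comp (Primrec.snd.comp he)) (Primrec.fst.comp (Primrec.snd.comp hf))
  exact primrecPred_imp
    (Primrec.eq.comp (Primrec.snd.comp (Primrec.snd.comp he)) (Primrec.fst.comp hf))
    (primrecPred_imp (primrecPred_mem (hB.comp ha) hm)
      (primrecPred_mem (hE.comp ha) (Primrec.pair (Primrec.fst.comp he)
        (Primrec.pair hm (Primrec.snd.comp (Primrec.snd.comp hf))))))

theorem primrecPred_avoids {s : α → Stack} {g : α → QMat} {c : α → Cert} (hs : Primrec s)
    (hg : Primrec g) (hc : Primrec c) : PrimrecPred fun a => (c a).Avoids (s a) (g a) := by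
  have hV : Primrec fun a => (c a).2.1 := Primrec.fst.comp (Primrec.snd.comp hc)
  have hE : Primrec fun a => (c a).2.2 := Primrec.snd.comp (Primrec.snd.comp hc)
  have hB : Primrec fun a => sanovBall (c a).1 := primrec_sanovBall.comp (Primrec.fst.comp hc)
  refine primrecPred_forall_mem (P := fun a (u : Node) => u.1 = [] → (¬SanovEquiv u.2 (g a) ∨
    ∃ x ∈ sanovBall (c a).1, QEq (qlmul x u.2) (g a) ∧
      ¬((s a, qone), (x, u)) ∈ (c a).2.2)) hV ?_
  refine primrecPred_imp (Primrec.eq.comp (Primrec.fst.comp Primrec.snd) (Primrec.const []))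
    ((primrecPred_sanovEquiv (Primrec.snd.comp Primrec.snd) (hg.comp Primrec.fst)).not.or ?_)
  refine primrecPred_exists_mem (P := fun (p : α × Node) (x : IMat) =>
    QEq (qlmul x p.2.2) (g p.1) ∧ ¬((s p.1, qone), (x, p.2)) ∈ (c p.1).2.2)
    (hB.comp Primrec.fst) ?_
  have ha : Primrec fun p : (α × Node) × IMat => p.1.1 := Primrec.fst.comp Primrec.fst
  have hu : Primrec fun p : (α × Node) × IMat => p.1.2 := Primrec.snd.comp Primrec.fst
  exact (primrecPred_qEq (primrec_qlmul Primrec.snd (Primrec.snd.comp hu)) (hg.comp ha)).and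
    (primrecPred_mem (hE.comp ha) (Primrec.pair (Primrec.pair (hs.comp ha) (Primrec.const _))
      (Primrec.pair Primrec.snd hu))).not

theorem primrecPred_refutes {s : α → Stack} {g : α → QMat} {c : α → Cert} (hs : Primrec s)
    (hg : Primrec g) (hc : Primrec c) : PrimrecPred fun a => (c a).Refutes (s a) (g a) := by
  have hV : Primrec fun a => (c a).2.1 := Primrec.fst.comp (Primrec.snd.comp hc)
  have hE : Primrec fun a => (c a).2.2 := Primrec.snd.comp (Primrec.snd.comp hc)
  refine ((primrecPred_mem hV (Primrec.pair hs (Primrec.const _))).and ?_).and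
    ((primrecPred_stepClosed hg hc).and
      ((primrecPred_compClosed hc).and (primrecPred_avoids hs hg hc)))
  exact primrecPred_forall_mem (P := fun a (u : Node) => (u, (ione, u)) ∈ (c a).2.2) hV
    (primrecPred_mem (hE.comp Primrec.fst)
      (Primrec.pair Primrec.snd (Primrec.pair (Primrec.const _) Primrec.snd)))

theorem primrec_termStack : Primrec termStack := by
  refine Primrec.list_cons.comp Primrec.fst (Primrec.list_flatMap Primrec.snd ?_)
  exact Primrec.list_cons.comp
    (primrec_char.comp (primrec_clearDen.comp (Primrec.fst.comp Primrec.snd)))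
    (Primrec.list_cons.comp (Primrec.snd.comp Primrec.snd) (Primrec.const []))

theorem primrec_termTarget : Primrec₂ termTarget := by
  have hd : Primrec termDen := by
    refine Primrec.list_foldr
      (h := fun _ (p : (MatCode × RegularExpression MatCode) × ℕ) => (commonDen p.1.1).2 * p.2)
      Primrec.snd
      (Primrec.const 1) ?_
    exact Primrec.nat_mul.comp (Primrec.snd.comp (primrec_commonDen.comp
      (Primrec.fst.comp (Primrec.fst.comp Primrec.snd)))) (Primrec.snd.comp Primrec.snd)
  have hg : Primrec fun p : MatCode × Term => commonDen p.1 := primrec_commonDen.comp Primrec.fst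
  exact Primrec.pair (primrec_ismul (primrec_int_natCast.comp (hd.comp Primrec.snd))
    (Primrec.fst.comp hg)) (Primrec.snd.comp hg)

end Primrec

end FlatRat

namespace FlatRat

open Matrix MatrixGroups

/-! ### The matrices described by codes -/

/-- The rational matrix with the given integer entries. -/
def ival (x : IMat) : Matrix (Fin 2) (Fin 2) ℚ := !![(x.1.1 : ℚ), x.1.2; x.2.1, x.2.2]

/-- The rational matrix described by an integer matrix and a common denominator. -/
def qval (k : QMat) : Matrix (Fin 2) (Fin 2) ℚ :=
  !![(k.1.1.1 : ℚ) / k.2, k.1.1.2 / k.2; k.1.2.1 / k.2, k.1.2.2 / k.2]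

theorem imul_assoc (x y z : IMat) : imul (imul x y) z = imul x (imul y z) := by
  simp only [imul, Prod.mk.injEq]
  refine ⟨⟨?_, ?_⟩, ?_, ?_⟩ <;> ring

theorem imul_ione (x : IMat) : imul x ione = x := by simp [imul, ione]

theorem ione_imul (x : IMat) : imul ione x = x := by simp [imul, ione]

theorem qmul_assoc (k l m : QMat) : qmul (qmul k l) m = qmul k (qmul l m) := by
  simp [qmul, imul_assoc, mul_assoc]

theorem qmul_qone (k : QMat) : qmul k qone = k := by simp [qmul, qone, imul_ione]

theorem qone_qmul (k : QMat) : qmul qone k = k := by simp [qmul, qone, ione_imul]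

theorem qval_qmul (k l : QMat) : qval (qmul k l) = qval k * qval l := by
  ext i j
  fin_cases i <;> fin_cases j <;>
    simp [qval, qmul, imul, Matrix.mul_apply, Fin.sum_univ_two, div_eq_mul_inv] <;> ring

theorem qval_qone : qval qone = 1 := by
  simp [qval, qone, ione, Matrix.one_fin_two]

theorem ival_ione : ival ione = 1 := by
  simp [ival, ione, Matrix.one_fin_two]

theorem ival_imul (x y : IMat) : ival (imul x y) = ival x * ival y := by
  ext i j
  fin_cases i <;> fin_cases j <;> simp [ival, imul, Matrix.mul_apply, Fin.sum_univ_two]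

theorem ival_injective : Function.Injective ival := by
  intro x y h
  have h00 := congrFun (congrFun h 0) 0
  have h01 := congrFun (congrFun h 0) 1
  have h10 := congrFun (congrFun h 1) 0
  have h11 := congrFun (congrFun h 1) 1
  simp [ival] at h00 h01 h10 h11
  exact Prod.ext (Prod.ext h00 h01) (Prod.ext h10 h11)

theorem qval_eq_smul (k : QMat) : qval k = (k.2 : ℚ)⁻¹ • ival k.1 := by
  ext i j
  fin_cases i <;> fin_cases j <;> simp [qval, ival, div_eq_inv_mul]

theorem qval_qlmul (x : IMat) (k : QMat) : qval (qlmul x k) = ival x * qval k := by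
  rw [qval_eq_smul, qval_eq_smul, qlmul, ival_imul, Matrix.mul_smul]

theorem ival_ismul (n : ℤ) (x : IMat) : ival (ismul n x) = (n : ℚ) • ival x := by
  ext i j
  fin_cases i <;> fin_cases j <;> simp [ismul, ival]

theorem qEq_iff {k l : QMat} (hk : k.2 ≠ 0) (hl : l.2 ≠ 0) : QEq k l ↔ qval k = qval l := by
  have hk' : (k.2 : ℚ) ≠ 0 := by exact_mod_cast hk
  have hl' : (l.2 : ℚ) ≠ 0 := by exact_mod_cast hl
  rw [QEq, ← ival_injective.eq_iff, ival_ismul, ival_ismul, qval_eq_smul, qval_eq_smul]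
  push_cast
  constructor
  · intro h
    rw [inv_smul_eq_iff₀ hk', smul_comm, ← h, inv_smul_smul₀ hl']
  · intro h
    rw [inv_smul_eq_iff₀ hk', smul_comm] at h
    rw [h, smul_inv_smul₀ hl']

theorem det_ival (x : IMat) : (ival x).det = idet x := by
  simp [ival, idet, Matrix.det_fin_two]

theorem det_qval (k : QMat) : (qval k).det = idet k.1 / ((k.2 : ℚ) * k.2) := by
  rw [qval_eq_smul, Matrix.det_smul, det_ival]
  simp
  ring

theorem abs_det_qval (k : QMat) :
    |(qval k).det| = ((idet k.1).natAbs : ℚ) / ((k.2 * k.2 : ℕ) : ℚ) := by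
  rw [det_qval, abs_div, Nat.cast_natAbs, Int.cast_abs]
  congr 1
  push_cast
  exact abs_of_nonneg (by positivity)

theorem exceeds_iff {k g : QMat} (hk : k.2 ≠ 0) (hg : g.2 ≠ 0) :
    Exceeds k g ↔ |(qval g).det| < |(qval k).det| := by
  have hk' : (0 : ℚ) < ((k.2 * k.2 : ℕ) : ℚ) := by exact_mod_cast Nat.pos_of_ne_zero (by positivity)
  have hg' : (0 : ℚ) < ((g.2 * g.2 : ℕ) : ℚ) := by exact_mod_cast Nat.pos_of_ne_zero (by positivity)
  rw [abs_det_qval, abs_det_qval, div_lt_div_iff₀ hg' hk', Exceeds]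
  exact_mod_cast Iff.rfl

theorem Admissible.one_lt_or {k : QMat} (hk : Admissible k) :
    1 < |(qval k).det| ∨ (k.2 = 1 ∧ |(qval k).det| = 1) := by
  have hk' : (0 : ℚ) < ((k.2 * k.2 : ℕ) : ℚ) := by
    exact_mod_cast Nat.pos_of_ne_zero (mul_ne_zero hk.1 hk.1)
  rw [abs_det_qval]
  rcases hk.2 with h | ⟨h1, h2⟩
  · left
    rw [one_lt_div hk']
    exact_mod_cast h
  · right
    simp [h1, h2]

theorem Admissible.one_le {k : QMat} (hk : Admissible k) : 1 ≤ |(qval k).det| := by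
  rcases hk.one_lt_or with h | h
  · exact h.le
  · exact h.2.ge

theorem admissible_qone : Admissible qone := by
  simp [Admissible, qone, ione, idet]

/-! ### Balls and cosets of the Sanov subgroup in terms of codes -/

/-- The entries of a matrix in `SL(2,ℤ)`. -/
def entries (m : SL(2, ℤ)) : IMat := ((m.1 0 0, m.1 0 1), (m.1 1 0, m.1 1 1))

theorem entries_mul (m n : SL(2, ℤ)) : entries (m * n) = imul (entries m) (entries n) := by
  simp [entries, imul, Matrix.mul_apply, Fin.sum_univ_two]

theorem entries_one : entries 1 = ione := by simp [entries, ione]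

theorem idet_entries (m : SL(2, ℤ)) : idet (entries m) = 1 := by
  have := m.2
  rwa [Matrix.det_fin_two] at this

theorem entries_injective : Function.Injective entries := by
  intro m n h
  simp only [entries, Prod.mk.injEq] at h
  ext i j
  fin_cases i <;> fin_cases j <;> simp [h]

theorem mem_sanovGens {x : IMat} : x ∈ sanovGens ↔
    ∃ a : Bool × Bool, x = entries (sanov (FreeGroup.mk [a])) := by
  have h1 : entries (sanovGen true) = ((1, 2), (0, 1)) := by simp [entries, sanovGen]
  have h2 : entries (sanovGen false) = ((1, 0), (2, 1)) := by simp [entries, sanovGen]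
  have h3 : entries (sanovGen true)⁻¹ = ((1, -2), (0, 1)) := by
    rw [← mul_one (sanovGen true)⁻¹]
    simp only [entries, sanovGen_true_inv_mul]
    simp
  have h4 : entries (sanovGen false)⁻¹ = ((1, 0), (-2, 1)) := by
    rw [← mul_one (sanovGen false)⁻¹]
    simp only [entries, sanovGen_false_inv_mul]
    simp
  simp [sanovGens, sanov, h1, h2, h3, h4]
  tauto

/-- The induction runs over arbitrary words, since prepending a letter need not give a reduced word.
Reduced words are the shortest, so word length and norm define the same ball. -/
theorem mem_sanovBall {N : ℕ} {x : IMat} :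
    x ∈ sanovBall N ↔ ∃ w : FreeGroup Bool, w.norm ≤ N ∧ entries (sanov w) = x := by
  have key : ∀ N x, x ∈ sanovBall N ↔
      ∃ L : List (Bool × Bool), L.length ≤ N ∧ entries (sanov (FreeGroup.mk L)) = x := by
    intro N
    induction N with
    | zero =>
      intro x
      have h : FreeGroup.mk ([] : List (Bool × Bool)) = 1 := FreeGroup.one_eq_mk.symm
      simp [sanovBall, List.length_eq_zero_iff, h, entries_one, eq_comm]
    | succ N ih =>
      intro x
      simp only [sanovBall, List.mem_append, List.mem_flatMap, List.mem_map, ih, mem_sanovGens]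
      constructor
      · rintro (⟨L, hL, rfl⟩ | ⟨_, ⟨L, hL, rfl⟩, _, ⟨a, rfl⟩, rfl⟩)
        · exact ⟨L, by omega, rfl⟩
        · refine ⟨a :: L, by simpa using hL, ?_⟩
          rw [← entries_mul, ← map_mul, FreeGroup.mul_mk, List.singleton_append]
      · rintro ⟨L, hL, rfl⟩
        match L, hL with
        | [], _ => exact Or.inl ⟨[], by simp, rfl⟩
        | a :: L, hL =>
          refine Or.inr ⟨_, ⟨L, by simpa using hL, rfl⟩, _, ⟨a, rfl⟩, ?_⟩
          rw [← entries_mul, ← map_mul, FreeGroup.mul_mk, List.singleton_append]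
  rw [key]
  constructor
  · rintro ⟨L, hL, h⟩
    exact ⟨_, FreeGroup.norm_mk_le.trans hL, h⟩
  · rintro ⟨w, hw, h⟩
    exact ⟨w.toWord, hw, by rw [FreeGroup.mk_toWord, h]⟩

theorem imul_iadj (x : IMat) : ival (imul x (iadj x)) = (idet x : ℚ) • 1 := by
  ext i j
  fin_cases i <;> fin_cases j <;> simp [ival, imul, iadj, idet] <;> ring

theorem imul_iadj' (x : IMat) : ival (iadj x) * ival x = (idet x : ℚ) • 1 := by
  rw [← ival_imul]
  ext i j
  fin_cases i <;> fin_cases j <;> simp [ival, imul, iadj, idet] <;> ring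

/-- By the adjugate formula `g k⁻¹` is `sanovQuotNum k g` divided by `sanovQuotDen k g`.
Divisibility by suitable multiples of this denominator, together with the determinant condition,
expresses the Sanov congruences. -/
theorem sanovEquiv_iff {k g : QMat} (hk : k.2 ≠ 0) (hg : g.2 ≠ 0) (hd : idet k.1 ≠ 0) :
    SanovEquiv k g ↔ ∃ w, qval g = ival (entries (sanov w)) * qval k := by
  have hk' : (k.2 : ℚ) ≠ 0 := by exact_mod_cast hk
  have hg' : (g.2 : ℚ) ≠ 0 := by exact_mod_cast hg
  have hd' : (idet k.1 : ℚ) ≠ 0 := by exact_mod_cast hd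
  have hm : sanovQuotDen k g ≠ 0 := mul_ne_zero (by exact_mod_cast hg) hd
  have hnum (y : IMat) : qval g = ival y * qval k ↔
      sanovQuotNum k g = ismul (sanovQuotDen k g) y := by
    rw [← ival_injective.eq_iff, sanovQuotNum, ival_ismul, ival_ismul, ival_imul, sanovQuotDen,
      qval_eq_smul, qval_eq_smul]
    push_cast
    constructor
    · intro h
      rw [inv_smul_eq_iff₀ hg', Matrix.mul_smul] at h
      rw [h, smul_mul_assoc, smul_mul_assoc, mul_assoc, ← ival_imul, imul_iadj, Matrix.mul_smul,
        mul_one, smul_smul, smul_smul, smul_smul]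
      congr 1
      field_simp
    · intro h
      have h2 := congrArg (· * ival k.1) h
      simp only [smul_mul_assoc, mul_assoc] at h2
      rw [imul_iadj', Matrix.mul_smul, mul_one, smul_smul] at h2
      have h3 := congrArg (fun m => ((g.2 : ℚ)⁻¹ * (k.2 : ℚ)⁻¹ * (idet k.1 : ℚ)⁻¹) • m) h2
      simp only [smul_smul] at h3
      rw [Matrix.mul_smul]
      convert h3 using 2 <;> field_simp
  constructor
  · rintro ⟨⟨a, ha⟩, ⟨b, hb⟩, ⟨c, hc⟩, ⟨d, hd⟩, hdet⟩
    have ha' : (sanovQuotNum k g).1.1 = sanovQuotDen k g * (4 * a + 1) := by linarith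
    have hb' : (sanovQuotNum k g).1.2 = sanovQuotDen k g * (2 * b) := by linarith
    have hc' : (sanovQuotNum k g).2.1 = sanovQuotDen k g * (2 * c) := by linarith
    have hdet' : (4 * a + 1) * d - (2 * b) * (2 * c) = 1 := by
      rw [idet, ha', hb', hc', hd] at hdet
      have : (sanovQuotDen k g * sanovQuotDen k g) * ((4 * a + 1) * d - (2 * b) * (2 * c)) =
        (sanovQuotDen k g * sanovQuotDen k g) * 1 := by linarith
      exact mul_left_cancel₀ (mul_ne_zero hm hm) this
    obtain ⟨w, hw⟩ := exists_sanov_eq (m := ⟨!![4 * a + 1, 2 * b; 2 * c, d], by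
      rw [Matrix.det_fin_two]; simpa using hdet'⟩) (by
        -- Oddness of the last entry is not part of `SanovEquiv`; it follows from the determinant.
        have : d % 2 = 1 := by
          have h : d = 1 + 2 * (2 * b * c - 2 * a * d) := by linarith
          omega
        simp [SanovCongr, this])
    refine ⟨w, (hnum _).2 ?_⟩
    rw [hw]
    exact Prod.ext (Prod.ext ha' hb') (Prod.ext hc' hd)
  · rintro ⟨w, hw⟩
    rw [hnum] at hw
    obtain ⟨h1, h2, h3, -⟩ := sanovCongr_sanov w
    have hdet := idet_entries (sanov w)
    rw [SanovEquiv, hw]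
    refine ⟨?_, ?_, ?_, dvd_mul_right _ _, ?_⟩
    · obtain ⟨t, ht⟩ : ∃ t, (sanov w).1 0 0 = 4 * t + 1 := ⟨(sanov w).1 0 0 / 4, by omega⟩
      exact ⟨t, by simp only [ismul, entries, ht]; ring⟩
    · obtain ⟨t, ht⟩ : ∃ t, (sanov w).1 0 1 = 2 * t := ⟨(sanov w).1 0 1 / 2, by omega⟩
      exact ⟨t, by simp only [ismul, entries, ht]; ring⟩
    · obtain ⟨t, ht⟩ : ∃ t, (sanov w).1 1 0 = 2 * t := ⟨(sanov w).1 1 0 / 2, by omega⟩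
      exact ⟨t, by simp only [ismul, entries, ht]; ring⟩
    · have : idet (ismul (sanovQuotDen k g) (entries (sanov w))) =
        sanovQuotDen k g * sanovQuotDen k g * idet (entries (sanov w)) := by
        simp only [idet, ismul]; ring
      rw [this, hdet, mul_one]

/-! ### Paths of unfoldings -/

/-- The stack `s` unfolds to `t`, splitting off a product of matrices. -/
inductive Path (s : Stack) : QMat → Stack → Prop
  | refl : Path s qone s
  | step {k : QMat} {t : Stack} (p : QMat × Stack) :
      Path s k t → p ∈ next t → Path s (qmul k p.1) p.2

theorem Path.trans {s t r : Stack} {k l : QMat} (h : Path s k t) (h' : Path t l r) :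
    Path s (qmul k l) r := by
  induction h' with
  | refl => rwa [qmul_qone]
  | step p _ hp ih => rw [← qmul_assoc]; exact ih.step p hp

theorem Path.single {s : Stack} {p : QMat × Stack} (hp : p ∈ next s) : Path s p.1 p.2 := by
  simpa [qone_qmul] using Path.refl.step p hp

theorem path_iff_exists_mem_reachAt {s t : Stack} {k : QMat} :
    Path s k t ↔ ∃ n, (t, k) ∈ reachAt s n := by
  constructor
  · intro h
    induction h with
    | refl => exact ⟨0, by simp [reachAt]⟩
    | step p _ hp ih =>
      obtain ⟨n, hn⟩ := ih
      exact ⟨n + 1, List.mem_flatMap.2 ⟨_, hn, List.mem_map.2 ⟨p, hp, rfl⟩⟩⟩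
  · rintro ⟨n, hn⟩
    induction n generalizing t k with
    | zero =>
      simp only [reachAt, List.mem_singleton, Prod.mk.injEq] at hn
      obtain ⟨rfl, rfl⟩ := hn
      exact .refl
    | succ n ih =>
      obtain ⟨⟨t', k'⟩, hu, hn'⟩ := List.mem_flatMap.1 hn
      obtain ⟨p, hp, he⟩ := List.mem_map.1 hn'
      cases he
      exact (ih hu).step p hp

/-- All matrices occurring in the unfolding of `s` are admissible. -/
def IsAdmissible (s : Stack) : Prop := ∀ k t, Path s k t → ∀ p ∈ next t, Admissible p.1

theorem Path.den_ne_zero {s t : Stack} {k : QMat} (hs : IsAdmissible s) (h : Path s k t) :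
    k.2 ≠ 0 := by
  induction h with
  | refl => simp [qone]
  | step p h hp ih => exact mul_ne_zero ih (hs _ _ h p hp).1

theorem Path.one_le_abs_det {s t : Stack} {k : QMat} (hs : IsAdmissible s) (h : Path s k t) :
    1 ≤ |(qval k).det| := by
  induction h with
  | refl => simp [qval_qone]
  | step p h hp ih =>
    rw [qval_qmul, Matrix.det_mul, abs_mul]
    exact one_le_mul_of_one_le_of_one_le ih (hs _ _ h p hp).one_le

/-- The set of matrices described by an expression. -/
def exprSet (E : RegularExpression MatCode) : Set (Matrix (Fin 2) (Fin 2) ℚ) :=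
  ratSet (E.map fun a => qval (commonDen a))

/-- The set of matrices described by a product of expressions. -/
def stackSet (s : Stack) : Set (Matrix (Fin 2) (Fin 2) ℚ) := (s.map exprSet).prod

theorem stackSet_cons (E : RegularExpression MatCode) (s : Stack) :
    stackSet (E :: s) = exprSet E * stackSet s := by simp [stackSet]

theorem mul_mem_stackSet_of_mem_next {t : Stack} {p : QMat × Stack} (hp : p ∈ next t)
    {y : Matrix (Fin 2) (Fin 2) ℚ} (hy : y ∈ stackSet p.2) : qval p.1 * y ∈ stackSet t := by
  match t with
  | [] => simp [next] at hp
  | E :: r =>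
    rw [stackSet_cons]
    cases E with
    | zero => simp [next, unfoldHead] at hp
    | epsilon =>
      simp only [next, unfoldHead, List.mem_singleton] at hp
      subst hp
      rw [qval_qone]
      exact Set.mul_mem_mul rfl hy
    | char a =>
      simp only [next, unfoldHead, List.mem_singleton] at hp
      subst hp
      exact Set.mul_mem_mul rfl hy
    | plus E F =>
      simp only [next, unfoldHead, List.mem_cons, List.not_mem_nil, or_false] at hp
      rcases hp with rfl | rfl
      · rw [qval_qone, one_mul]
        rw [stackSet_cons] at hy
        exact Set.mul_subset_mul_right Set.subset_union_left hy
      · rw [qval_qone, one_mul]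
        rw [stackSet_cons] at hy
        exact Set.mul_subset_mul_right Set.subset_union_right hy
    | comp E F =>
      simp only [next, unfoldHead, List.mem_singleton] at hp
      subst hp
      rw [stackSet_cons, stackSet_cons, ← mul_assoc] at hy
      rwa [qval_qone, one_mul]
    | star E =>
      simp only [next, unfoldHead, List.mem_cons, List.not_mem_nil, or_false] at hp
      rcases hp with rfl | rfl
      · rw [qval_qone]
        exact Set.mul_mem_mul (Submonoid.one_mem _) hy
      · rw [qval_qone, one_mul]
        rw [stackSet_cons, stackSet_cons, ← mul_assoc] at hy
        refine Set.mul_subset_mul_right ?_ hy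
        rintro _ ⟨a, ha, b, hb, rfl⟩
        exact Submonoid.mul_mem _ (Submonoid.subset_closure ha) hb

theorem Path.mul_mem_stackSet {s t : Stack} {k : QMat} (h : Path s k t)
    {y : Matrix (Fin 2) (Fin 2) ℚ} (hy : y ∈ stackSet t) : qval k * y ∈ stackSet s := by
  induction h generalizing y with
  | refl => simpa [qval_qone] using hy
  | step p _ hp ih =>
    rw [qval_qmul, mul_assoc]
    exact ih (mul_mem_stackSet_of_mem_next hp hy)

/-- The remainder `r` is arbitrary so that the induction hypothesis applies with `F :: r` below a
concatenation, and with the star itself as remainder, where a factor gives a loop at `.star E :: r`.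
-/
theorem exists_path_of_mem_exprSet (E : RegularExpression MatCode) :
    ∀ x ∈ exprSet E, ∀ r, ∃ k, Path (E :: r) k r ∧ qval k = x := by
  induction E with
  | zero => exact fun x hx => hx.elim
  | epsilon =>
    rintro x rfl r
    exact ⟨qone, Path.single (p := (qone, r)) (by simp [next, unfoldHead]), qval_qone⟩
  | char a =>
    rintro x rfl r
    exact ⟨commonDen a, Path.single (p := (commonDen a, r)) (by simp [next, unfoldHead]), rfl⟩
  | plus E F hE hF =>
    rintro x (hx | hx) r
    · obtain ⟨k, hk, rfl⟩ := hE x hx r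
      refine ⟨qmul qone k, Path.trans
        (Path.single (p := (qone, E :: r)) (by simp [next, unfoldHead])) hk, by rw [qone_qmul]⟩
    · obtain ⟨k, hk, rfl⟩ := hF x hx r
      refine ⟨qmul qone k, Path.trans
        (Path.single (p := (qone, F :: r)) (by simp [next, unfoldHead])) hk, by rw [qone_qmul]⟩
  | comp E F hE hF =>
    rintro _ ⟨x, hx, y, hy, rfl⟩ r
    obtain ⟨k, hk, rfl⟩ := hE x hx (F :: r)
    obtain ⟨l, hl, rfl⟩ := hF y hy r
    refine ⟨qmul qone (qmul k l), Path.trans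
      (Path.single (p := (qone, E :: F :: r)) (by simp [next, unfoldHead])) (hk.trans hl), ?_⟩
    rw [qone_qmul, qval_qmul]
  | star E hE =>
    intro x hx r
    have key : ∃ k, Path (.star E :: r) k (.star E :: r) ∧ qval k = x := by
      refine Submonoid.closure_induction (s := exprSet E)
        (motive := fun x _ => ∃ k, Path (.star E :: r) k (.star E :: r) ∧ qval k = x)
        ?_ ?_ ?_ hx
      · intro x hx
        obtain ⟨k, hk, rfl⟩ := hE x hx (.star E :: r)
        refine ⟨qmul qone k, Path.trans (Path.single (p := (qone, E :: .star E :: r))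
          (by simp [next, unfoldHead])) hk, by rw [qone_qmul]⟩
      · exact ⟨qone, .refl, qval_qone⟩
      · rintro x y - - ⟨k, hk, rfl⟩ ⟨l, hl, rfl⟩
        exact ⟨qmul k l, hk.trans hl, qval_qmul k l⟩
    obtain ⟨k, hk, rfl⟩ := key
    exact ⟨qmul k qone, hk.step (qone, r) (by simp [next, unfoldHead]), by rw [qmul_qone]⟩

theorem mem_stackSet_iff {s : Stack} {x : Matrix (Fin 2) (Fin 2) ℚ} :
    x ∈ stackSet s ↔ ∃ k, Path s k [] ∧ qval k = x := by
  constructor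
  · intro hx
    induction s generalizing x with
    | nil => exact ⟨qone, .refl, by rw [qval_qone]; exact (Set.mem_one.1 hx).symm⟩
    | cons E s ih =>
      rw [stackSet_cons] at hx
      obtain ⟨a, ha, b, hb, rfl⟩ := hx
      obtain ⟨k, hk, rfl⟩ := exists_path_of_mem_exprSet E a ha s
      obtain ⟨l, hl, rfl⟩ := ih hb
      exact ⟨qmul k l, hk.trans hl, qval_qmul k l⟩
  · rintro ⟨k, hk, rfl⟩
    simpa using hk.mul_mem_stackSet (y := 1) rfl

/-- Only finitely many products of expressions occur in the unfolding of a given one. -/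
theorem finite_setOf_path (s : Stack) : {t | ∃ k, Path s k t}.Finite := by
  -- Pushing `E` on a stack of `S` creates only finitely many new stacks. Steps are controlled only
  -- from stacks outside `S`, so `S` itself need not be closed; the star case relies on this.
  have key : ∀ (E : RegularExpression MatCode) (r : Stack) (S : Set Stack), S.Finite → r ∈ S →
      ∃ S' : Set Stack, S'.Finite ∧ S ⊆ S' ∧ E :: r ∈ S' ∧
        ∀ t ∈ S', t ∉ S → ∀ p ∈ next t, p.2 ∈ S' := by
    intro E
    induction E with
    | zero =>
      intro r S hS hr
      refine ⟨insert (.zero :: r) S, hS.insert _, Set.subset_insert _ _, Set.mem_insert _ _, ?_⟩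
      rintro t (rfl | ht) ht' p hp
      · simp [next, unfoldHead] at hp
      · exact absurd ht ht'
    | epsilon =>
      intro r S hS hr
      refine ⟨insert (.epsilon :: r) S, hS.insert _, Set.subset_insert _ _,
        Set.mem_insert _ _, ?_⟩
      rintro t (rfl | ht) ht' p hp
      · simp only [next, unfoldHead, List.mem_singleton] at hp
        subst hp
        exact Set.mem_insert_of_mem _ hr
      · exact absurd ht ht'
    | char a =>
      intro r S hS hr
      refine ⟨insert (.char a :: r) S, hS.insert _, Set.subset_insert _ _,
        Set.mem_insert _ _, ?_⟩
      rintro t (rfl | ht) ht' p hp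
      · simp only [next, unfoldHead, List.mem_singleton] at hp
        subst hp
        exact Set.mem_insert_of_mem _ hr
      · exact absurd ht ht'
    | plus E F hE hF =>
      intro r S hS hr
      obtain ⟨S₁, h1, h2, h3, h4⟩ := hE r S hS hr
      obtain ⟨S₂, k1, k2, k3, k4⟩ := hF r S hS hr
      refine ⟨insert (.plus E F :: r) (S₁ ∪ S₂), (h1.union k1).insert _,
        h2.trans (Set.subset_union_left.trans (Set.subset_insert _ _)), Set.mem_insert _ _, ?_⟩
      rintro t (rfl | ht | ht) ht' p hp
      · simp only [next, unfoldHead, List.mem_cons, List.not_mem_nil, or_false] at hp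
        rcases hp with rfl | rfl
        · exact Or.inr (Or.inl h3)
        · exact Or.inr (Or.inr k3)
      · exact Or.inr (Or.inl (h4 t ht ht' p hp))
      · exact Or.inr (Or.inr (k4 t ht ht' p hp))
    | comp E F hE hF =>
      intro r S hS hr
      obtain ⟨S₁, h1, h2, h3, h4⟩ := hF r S hS hr
      obtain ⟨S₂, k1, k2, k3, k4⟩ := hE (F :: r) S₁ h1 h3
      refine ⟨insert (.comp E F :: r) S₂, k1.insert _,
        h2.trans (k2.trans (Set.subset_insert _ _)), Set.mem_insert _ _, ?_⟩
      rintro t (rfl | ht) ht' p hp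
      · simp only [next, unfoldHead, List.mem_singleton] at hp
        subst hp
        exact Or.inr k3
      · by_cases ht1 : t ∈ S₁
        · exact Or.inr (k2 (h4 t ht1 ht' p hp))
        · exact Or.inr (k4 t ht ht1 p hp)
    | star E hE =>
      intro r S hS hr
      -- The stack `.star E :: r` is put into the set beforehand, since unfolding `E` returns to it;
      -- its own two steps are checked afterwards.
      obtain ⟨S₁, h1, h2, h3, h4⟩ := hE (.star E :: r) (insert (.star E :: r) S) (hS.insert _)
        (Set.mem_insert _ _)
      refine ⟨S₁, h1, (Set.subset_insert _ _).trans h2, h2 (Set.mem_insert _ _), ?_⟩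
      intro t ht ht' p hp
      by_cases ht1 : t = .star E :: r
      · subst ht1
        simp only [next, unfoldHead, List.mem_cons, List.not_mem_nil, or_false] at hp
        rcases hp with rfl | rfl
        · exact h2 (Set.mem_insert_of_mem _ hr)
        · exact h3
      · exact h4 t ht (fun h => h.elim ht1 ht') p hp
  have closed : ∃ S : Set Stack, S.Finite ∧ s ∈ S ∧ ∀ t ∈ S, ∀ p ∈ next t, p.2 ∈ S := by
    induction s with
    | nil => exact ⟨{[]}, Set.finite_singleton _, rfl, by rintro t rfl p hp; simp [next] at hp⟩
    | cons E s ih =>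
      obtain ⟨S, h1, h2, h3⟩ := ih
      obtain ⟨S', k1, k2, k3, k4⟩ := key E s S h1 h2
      refine ⟨S', k1, k3, fun t ht p hp => ?_⟩
      by_cases h : t ∈ S
      · exact k2 (h3 t h p hp)
      · exact k4 t ht h p hp
  obtain ⟨S, h1, h2, h3⟩ := closed
  refine h1.subset ?_
  rintro t ⟨k, hk⟩
  induction hk with
  | refl => exact h2
  | step p _ hp ih => exact h3 _ ih p hp

end FlatRat

namespace FlatRat

open Matrix MatrixGroups

/-! ### Certificates are sound and complete -/

/-- The rational matrix of an element of the Sanov subgroup. -/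
def sanovMat (w : FreeGroup Bool) : Matrix (Fin 2) (Fin 2) ℚ := ival (entries (sanov w))

theorem sanovMat_one : sanovMat 1 = 1 := by rw [sanovMat, map_one, entries_one, ival_ione]

theorem sanovMat_mul (v w : FreeGroup Bool) : sanovMat (v * w) = sanovMat v * sanovMat w := by
  rw [sanovMat, map_mul, entries_mul, ival_imul]; rfl

theorem det_sanovMat (w : FreeGroup Bool) : (sanovMat w).det = 1 := by
  rw [sanovMat, det_ival, idet_entries, Int.cast_one]

theorem sanovMat_injective : Function.Injective sanovMat :=
  ival_injective.comp (entries_injective.comp sanov_injective)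

/-- The edges of a certificate, labelled in the free group. -/
def Cert.FreeEdge (c : Cert) (u : Node) (w : FreeGroup Bool) (v : Node) : Prop :=
  w.norm ≤ c.1 ∧ (u, (entries (sanov w), v)) ∈ c.2.2

/-- Every path of small determinant can be followed inside the certificate, with the Sanov factors
collected on the left. Prefixes of the path have no larger determinant, and Sanov matrices have
determinant one, so the alternative `Exceeds` never occurs. -/
theorem Cert.StepClosed.exists_edgePath {s : Stack} {g : QMat} {c : Cert} (hs : IsAdmissible s)
    (hg : g.2 ≠ 0) (hc : c.StepClosed g) (hs0 : (s, qone) ∈ c.2.1) {k : QMat} {t : Stack}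
    (h : Path s k t) (hk : |(qval k).det| ≤ |(qval g).det|) :
    ∃ v ∈ c.2.1, v.1 = t ∧ v.2.2 ≠ 0 ∧ ∃ l : List (FreeGroup Bool),
      EdgePath c.FreeEdge (s, qone) l v ∧ qval k = sanovMat l.prod * qval v.2 := by
  induction h with
  | refl =>
    exact ⟨_, hs0, rfl, by simp [qone], [], rfl, by simp [sanovMat_one]⟩
  | @step k t p h hp ih =>
    have hadm := hs _ _ h p hp
    have hle : |(qval k).det| ≤ |(qval (qmul k p.1)).det| := by
      rw [qval_qmul, Matrix.det_mul, abs_mul]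
      exact le_mul_of_one_le_right (abs_nonneg _) hadm.one_le
    obtain ⟨v, hv, rfl, hv2, l, hl, hkv⟩ := ih (hle.trans hk)
    have hq : qval (qmul k p.1) = sanovMat l.prod * qval (qmul v.2 p.1) := by
      rw [qval_qmul, qval_qmul, hkv, mul_assoc]
    have hden : (qmul v.2 p.1).2 ≠ 0 := mul_ne_zero hv2 hadm.1
    rcases hc v hv p hp with hex | ⟨v', hv', ⟨h1, h2⟩, x, hx, hxE, hxq⟩
    · rw [exceeds_iff hden hg] at hex
      rw [hq, Matrix.det_mul, det_sanovMat, one_mul] at hk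
      exact absurd hk (not_le.2 hex)
    · obtain ⟨w, hw, rfl⟩ := mem_sanovBall.1 hx
      refine ⟨v', hv', h1, h2, l ++ [w], edgePath_append.2 ⟨v, hl, v', ⟨hw, hxE⟩, rfl⟩, ?_⟩
      rw [qEq_iff hden (by exact h2), qval_qlmul] at hxq
      rw [hq, hxq, List.prod_append, List.prod_singleton, sanovMat_mul, mul_assoc]
      rfl

/-- A path yielding `g` ends at a final node `v` of the certificate with `g` equal to a Sanov matrix
times `v.2`. The certificate names such a factor within the ball, and cancelling the invertible
`v.2` identifies it with the product of the edge labels. Saturation then produces the edge that the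
certificate is required not to have. -/
theorem Cert.Refutes.notMem {s : Stack} {g : QMat} {c : Cert} (hc : c.Refutes s g)
    (hs : IsAdmissible s) (hg : g.2 ≠ 0) : qval g ∉ stackSet s := by
  intro hmem
  obtain ⟨⟨hs0, hrefl⟩, hstep, hcomp, hav⟩ := hc
  obtain ⟨k, hk, hkg⟩ := mem_stackSet_iff.1 hmem
  obtain ⟨v, hv, hvnil, hv2, l, hl, hkv⟩ := hstep.exists_edgePath hs hg hs0 hk (by rw [hkg])
  have hdet : (qval v.2).det ≠ 0 := by
    have := hk.one_le_abs_det hs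
    rw [hkv, Matrix.det_mul, det_sanovMat, one_mul] at this
    intro h0
    rw [h0] at this
    norm_num at this
  have hidet : idet v.2.1 ≠ 0 := by
    intro h0
    rw [det_qval, h0] at hdet
    simp at hdet
  have hequiv : SanovEquiv v.2 g :=
    (sanovEquiv_iff hv2 hg hidet).2 ⟨l.prod, by rw [← hkg, hkv]; rfl⟩
  rcases hav v hv hvnil with h | ⟨x, hx, hxg, hxE⟩
  · exact h hequiv
  · obtain ⟨w, hw, rfl⟩ := mem_sanovBall.1 hx
    rw [qEq_iff (by exact hv2) hg, qval_qlmul, ← hkg, hkv] at hxg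
    have hunit : IsUnit (qval v.2) :=
      (Matrix.isUnit_iff_isUnit_det _).2 (isUnit_iff_ne_zero.2 hdet)
    have hwl : w = l.prod := sanovMat_injective (hunit.mul_right_cancel hxg)
    subst hwl
    refine hxE (edge_of_edgePath (T := c.FreeEdge) (N := c.1) (fun _ _ _ h => h.1) ?_ ?_ hl hw).2
    · intro u a m b n ha hb hab
      refine ⟨hab, ?_⟩
      rw [map_mul, entries_mul]
      exact hcomp _ ha.2 _ hb.2 rfl
        (mem_sanovBall.2 ⟨a * b, hab, by rw [map_mul, entries_mul]⟩)
    · refine ⟨by simp, ?_⟩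
      rw [map_one, entries_one]
      exact hrefl _ hs0

/-! ### Finiteness modulo the Sanov subgroup -/

/-- If `y = x + 4 (det x) z`, then `y x⁻¹ = 1 + 4 z (adj x)` is integral, has determinant one and
satisfies the Sanov congruences. So the determinant and the residues modulo four times it determine
the class. -/
theorem exists_sanovMat_mul_ival {x y : IMat} (hdet : idet y = idet x) (h0 : idet x ≠ 0)
    (h11 : 4 * idet x ∣ y.1.1 - x.1.1) (h12 : 4 * idet x ∣ y.1.2 - x.1.2)
    (h21 : 4 * idet x ∣ y.2.1 - x.2.1) (h22 : 4 * idet x ∣ y.2.2 - x.2.2) :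
    ∃ w, ival y = sanovMat w * ival x := by
  obtain ⟨a, ha⟩ := h11
  obtain ⟨b, hb⟩ := h12
  obtain ⟨c, hc⟩ := h21
  obtain ⟨d, hd⟩ := h22
  have hq (z : IMat) : qval (z, 1) = ival z := by simp [qval_eq_smul]
  have hs : SanovEquiv (x, 1) (y, 1) := by
    have hN : sanovQuotNum (x, 1) (y, 1) = imul y (iadj x) := by
      simp [sanovQuotNum, ismul]
    have hD : sanovQuotDen (x, 1) (y, 1) = idet x := by simp [sanovQuotDen]
    rw [SanovEquiv, hN, hD]
    have e1 : y.1.1 = x.1.1 + 4 * idet x * a := by linarith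
    have e2 : y.1.2 = x.1.2 + 4 * idet x * b := by linarith
    have e3 : y.2.1 = x.2.1 + 4 * idet x * c := by linarith
    have e4 : y.2.2 = x.2.2 + 4 * idet x * d := by linarith
    refine ⟨⟨a * x.2.2 - b * x.2.1, ?_⟩, ⟨2 * (b * x.1.1 - a * x.1.2), ?_⟩,
      ⟨2 * (c * x.2.2 - d * x.2.1), ?_⟩, ⟨1 + 4 * (d * x.1.1 - c * x.1.2), ?_⟩, ?_⟩
    · simp only [imul, iadj, e1, e2]
      rw [show idet x = x.1.1 * x.2.2 - x.1.2 * x.2.1 from rfl]; ring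
    · simp only [imul, iadj, e1, e2]
      rw [show idet x = x.1.1 * x.2.2 - x.1.2 * x.2.1 from rfl]; ring
    · simp only [imul, iadj, e3, e4]
      rw [show idet x = x.1.1 * x.2.2 - x.1.2 * x.2.1 from rfl]; ring
    · simp only [imul, iadj, e3, e4]
      rw [show idet x = x.1.1 * x.2.2 - x.1.2 * x.2.1 from rfl]; ring
    · have : idet (imul y (iadj x)) = idet y * idet x := by
        simp only [idet, imul, iadj]; ring
      rw [this, hdet]
  obtain ⟨w, hw⟩ := (sanovEquiv_iff (by simp) (by simp) h0).1 hs
  rw [hq, hq] at hw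
  exact ⟨w, hw⟩

/-- Applied to the determinants of the finitely many letters, this gives the factor by which a
letter outside `GL(2,ℤ)` must at least raise the determinant. -/
theorem exists_one_lt_le_of_finite {Λ : Set ℚ} (hΛ : Λ.Finite) :
    ∃ δ : ℚ, 1 < δ ∧ ∀ a ∈ Λ, 1 < a → δ ≤ a := by
  induction Λ, hΛ using Set.Finite.induction_on with
  | empty => exact ⟨2, by norm_num, by simp⟩
  | @insert a S _ _ ih =>
    obtain ⟨δ, h1, h2⟩ := ih
    by_cases ha : 1 < a
    · refine ⟨min a δ, lt_min ha h1, ?_⟩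
      rintro b (rfl | hb) h
      · exact min_le_left _ _
      · exact (min_le_right _ _).trans (h2 b hb h)
    · refine ⟨δ, h1, ?_⟩
      rintro b (rfl | hb) h
      · exact absurd h ha
      · exact h2 b hb h

theorem finite_letters (s : Stack) : {a | ∃ k t, Path s k t ∧ ∃ p ∈ next t, p.1 = a}.Finite := by
  have h : (⋃ t ∈ {t | ∃ k, Path s k t}, {a | ∃ p ∈ next t, p.1 = a}).Finite := by
    refine (finite_setOf_path s).biUnion fun t _ => ?_
    refine ((next t).map Prod.fst).finite_toSet.subset ?_
    rintro a ⟨p, hp, rfl⟩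
    exact List.mem_map_of_mem hp
  refine h.subset ?_
  rintro a ⟨k, t, hk, ha⟩
  exact Set.mem_biUnion (show t ∈ {t | ∃ k, Path s k t} from ⟨k, hk⟩) ha

/-- The products of bounded determinant which occur in the unfolding have a common denominator. -/
theorem exists_common_denominator {s : Stack} (hs : IsAdmissible s) (b : ℚ) :
    ∃ D : ℕ, D ≠ 0 ∧ ∀ k t, Path s k t → |(qval k).det| ≤ b →
      ∃ y : IMat, (D : ℚ) • qval k = ival y := by
  have hΛ := finite_letters s
  set Λ := {a | ∃ k t, Path s k t ∧ ∃ p ∈ next t, p.1 = a} with hΛdef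
  obtain ⟨δ, hδ, hδle⟩ := exists_one_lt_le_of_finite (hΛ.image fun a => |(qval a).det|)
  have hadm : ∀ a ∈ Λ, Admissible a := by
    rintro a ⟨k, t, hk, p, hp, rfl⟩
    exact hs k t hk p hp
  set D := ∏ a ∈ hΛ.toFinset, a.2 with hD
  have hD0 : D ≠ 0 := Finset.prod_ne_zero_iff.2 fun a ha =>
    (hadm a (hΛ.mem_toFinset.1 ha)).1
  have hint : ∀ a ∈ Λ, ∃ y : IMat, (D : ℚ) • qval a = ival y := by
    intro a ha
    obtain ⟨e, he⟩ : a.2 ∣ D := Finset.dvd_prod_of_mem _ (hΛ.mem_toFinset.2 ha)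
    have ha0 : (a.2 : ℚ) ≠ 0 := by exact_mod_cast (hadm a ha).1
    refine ⟨ismul e a.1, ?_⟩
    rw [ival_ismul, qval_eq_smul, smul_smul, he]
    congr 1
    push_cast
    field_simp
  -- `m` counts the letters of `|det| > 1`. Each of them costs one factor `D` in the denominator and
  -- contributes at least `δ` to the determinant; the other letters are integral.
  have key : ∀ k t, Path s k t → ∃ m : ℕ, (∃ y : IMat, ((D : ℚ) ^ m) • qval k = ival y) ∧
      δ ^ m ≤ |(qval k).det| := by
    intro k t h
    induction h with
    | refl => exact ⟨0, ⟨ione, by simp [qval_qone, ival_ione]⟩, by simp [qval_qone]⟩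
    | step p h hp ih =>
      obtain ⟨m, ⟨y, hy⟩, hm⟩ := ih
      have hpΛ : p.1 ∈ Λ := ⟨_, _, h, p, hp, rfl⟩
      have hpos : (0 : ℚ) ≤ δ ^ m := by positivity
      rw [qval_qmul, Matrix.det_mul, abs_mul]
      rcases (hadm _ hpΛ).one_lt_or with h1 | ⟨h1, h2⟩
      · obtain ⟨z, hz⟩ := hint _ hpΛ
        refine ⟨m + 1, ⟨imul y z, ?_⟩, ?_⟩
        · rw [ival_imul, ← hy, ← hz, smul_mul_smul_comm, pow_succ]
        · rw [pow_succ]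
          exact mul_le_mul hm (hδle _ ⟨_, hpΛ, rfl⟩ h1) (by positivity) (abs_nonneg _)
      · refine ⟨m, ⟨imul y p.1.1, ?_⟩, by rwa [h2, mul_one]⟩
        rw [ival_imul, ← hy, qval_eq_smul p.1, h1]
        simp
  obtain ⟨M, hM⟩ := pow_unbounded_of_one_lt b hδ
  refine ⟨D ^ M, pow_ne_zero _ hD0, fun k t hk hkb => ?_⟩
  obtain ⟨m, ⟨y, hy⟩, hm⟩ := key k t hk
  have hmM : m ≤ M := by
    by_contra hcon
    have := pow_le_pow_right₀ hδ.le (not_le.1 hcon).le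
    linarith
  refine ⟨ismul ((D : ℤ) ^ (M - m)) y, ?_⟩
  rw [ival_ismul, ← hy, smul_smul]
  congr 1
  push_cast
  rw [← pow_add, Nat.sub_add_cancel hmM]

/-- Modulo the Sanov subgroup, only finitely many nodes of bounded determinant occur. -/
theorem exists_finite_cover {s : Stack} (hs : IsAdmissible s) (b : ℚ) :
    ∃ V : Set Node, V.Finite ∧ (∀ u ∈ V, Path s u.2 u.1 ∧ |(qval u.2).det| ≤ b) ∧
      ∀ k t, Path s k t → |(qval k).det| ≤ b →
        ∃ v ∈ V, v.1 = t ∧ ∃ w, qval k = sanovMat w * qval v.2 := by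
  obtain ⟨D, hD0, hD⟩ := exists_common_denominator hs b
  have hDQ : (D : ℚ) ≠ 0 := by exact_mod_cast hD0
  let R : Set Node := {u | Path s u.2 u.1 ∧ |(qval u.2).det| ≤ b}
  -- Outside `R` the value is an arbitrary default, which makes `y` a total function of the node.
  have hy : ∀ u : Node, ∃ y : IMat, u ∈ R → (D : ℚ) • qval u.2 = ival y := by
    intro u
    by_cases hu : u ∈ R
    · obtain ⟨y, hy⟩ := hD u.2 u.1 hu.1 hu.2
      exact ⟨y, fun _ => hy⟩
    · exact ⟨ione, fun h => absurd h hu⟩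
  choose y hy using hy
  have hdet : ∀ u ∈ R, (idet (y u) : ℚ) = D ^ 2 * (qval u.2).det := by
    intro u hu
    rw [← det_ival, ← hy u hu, Matrix.det_smul]
    simp
  have hdet0 : ∀ u ∈ R, idet (y u) ≠ 0 := by
    intro u hu h0
    have h1 := hdet u hu
    have h2 := hu.1.one_le_abs_det hs
    rw [h0, Int.cast_zero, eq_comm, mul_eq_zero] at h1
    rcases h1 with h1 | h1
    · exact hDQ (pow_eq_zero_iff (by norm_num) |>.1 h1)
    · rw [h1] at h2
      norm_num at h2
  obtain ⟨B, hB⟩ : ∃ B : ℕ, ∀ u ∈ R, |idet (y u)| ≤ B := by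
    obtain ⟨B, hB⟩ := exists_nat_ge ((D : ℚ) ^ 2 * b)
    refine ⟨B, fun u hu => ?_⟩
    have h1 : |(idet (y u) : ℚ)| ≤ B := by
      rw [hdet u hu, abs_mul, abs_of_nonneg (by positivity)]
      exact (mul_le_mul_of_nonneg_left hu.2 (by positivity)).trans hB
    exact_mod_cast h1
  let r : Node → ℤ → ℤ := fun u z => z % (4 * idet (y u))
  -- The finite invariant: nodes of `R` with equal values have the same stack and differ by a Sanov
  -- factor. It takes finitely many values on `R` because the stacks, the determinants and hence the
  -- residues are bounded.
  let f : Node → Stack × ℤ × IMat := fun u => (u.1, idet (y u),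
    ((r u (y u).1.1, r u (y u).1.2), (r u (y u).2.1, r u (y u).2.2)))
  have hr : ∀ u ∈ R, ∀ z, r u z ∈ Set.Icc (0 : ℤ) (4 * B) := by
    intro u hu z
    have h4 : 4 * idet (y u) ≠ 0 := mul_ne_zero (by norm_num) (hdet0 u hu)
    refine ⟨Int.emod_nonneg _ h4, ?_⟩
    have h1 := Int.emod_lt_abs z h4
    have h2 := hB u hu
    rw [abs_mul, abs_of_nonneg (by norm_num : (0 : ℤ) ≤ 4)] at h1
    change z % (4 * idet (y u)) ≤ _
    linarith
  have hfin : (f '' R).Finite := by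
    have hI := Set.finite_Icc (0 : ℤ) (4 * B)
    refine ((finite_setOf_path s).prod ((Set.finite_Icc (-B : ℤ) B).prod
      ((hI.prod hI).prod (hI.prod hI)))).subset ?_
    rintro _ ⟨u, hu, rfl⟩
    exact ⟨⟨u.2, hu.1⟩, abs_le.1 (hB u hu), ⟨hr u hu _, hr u hu _⟩, ⟨hr u hu _, hr u hu _⟩⟩
  -- `V` has exactly one representative for each value of `f` on `R`.
  obtain ⟨V, hVR, hV⟩ := Set.exists_subset_bijOn R f
  refine ⟨V, hV.finite_iff_finite.2 hfin, fun u hu => hVR hu, fun k t hk hkb => ?_⟩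
  obtain ⟨v, hv, hvf⟩ := hV.surjOn ⟨(t, k), ⟨hk, hkb⟩, rfl⟩
  have hu : ((t, k) : Node) ∈ R := ⟨hk, hkb⟩
  simp only [f, Prod.mk.injEq] at hvf
  obtain ⟨h1, h2, ⟨h3, h4⟩, h5, h6⟩ := hvf
  have hmod : ∀ a b : ℤ, r v a = r (t, k) b → 4 * idet (y v) ∣ b - a := by
    intro a b hab
    simp only [r, ← h2] at hab
    exact Int.ModEq.dvd hab
  obtain ⟨w, hw⟩ := exists_sanovMat_mul_ival h2.symm (hdet0 v (hVR hv)) (hmod _ _ h3)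
    (hmod _ _ h4) (hmod _ _ h5) (hmod _ _ h6)
  refine ⟨v, hv, h1, w, ?_⟩
  rw [← hy _ hu, ← hy _ (hVR hv), Matrix.mul_smul] at hw
  exact smul_right_injective _ hDQ hw

/-- Finitely many solvable conditions have solutions in one common ball: choose one for each and
take the largest norm. This fixes the radius of a certificate. -/
theorem exists_norm_bound {X : Type*} {S : Set X} (hS : S.Finite)
    (P : X → FreeGroup Bool → Prop) :
    ∃ N, ∀ x ∈ S, (∃ w, P x w) → ∃ w, w.norm ≤ N ∧ P x w := by
  have h : ∀ x, ∃ w, (∃ w, P x w) → P x w := fun x => by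
    by_cases hx : ∃ w, P x w
    · exact ⟨hx.choose, fun _ => hx.choose_spec⟩
    · exact ⟨1, fun h => absurd h hx⟩
  choose w hw using h
  obtain ⟨N, hN⟩ := (hS.image fun x => (w x).norm).bddAbove
  exact ⟨N, fun x hx hex => ⟨w x, hN ⟨x, hx, rfl⟩, hw x hex⟩⟩

/-- Take as edges all true relations `u k = x v` between the finitely many nodes, with `k` realised
by a path and `x` in the ball. This set is closed under compositions staying in the ball, and an
edge from the start to a final node labelled by the quotient of `g` would be a path yielding `g`. -/
theorem exists_refutes {s : Stack} {g : QMat} (hs : IsAdmissible s) (hg : g.2 ≠ 0)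
    (hmem : qval g ∉ stackSet s) : ∃ c : Cert, c.Refutes s g := by
  obtain ⟨V₀, hV₀fin, hV₀, hcover⟩ := exists_finite_cover hs (max 1 |(qval g).det|)
  -- The cover may represent the class of the start by another node, whereas `Cert.Avoids` refers to
  -- the start itself.
  set V : Set Node := insert (s, qone) V₀ with hVdef
  have hVfin : V.Finite := hV₀fin.insert _
  have hV : ∀ u ∈ V, Path s u.2 u.1 := by
    rintro u (rfl | hu)
    · exact .refl
    · exact (hV₀ u hu).1
  have hVden : ∀ u ∈ V, u.2.2 ≠ 0 := fun u hu => (hV u hu).den_ne_zero hs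
  have hΛ := finite_letters s
  set Λ := {a | ∃ k t, Path s k t ∧ ∃ p ∈ next t, p.1 = a} with hΛdef
  -- The pairs for which a Sanov quotient must be found in the ball: `g` or the result of one step,
  -- against a node.
  have hXfin : (insert (qval g) (Set.image2 (fun (u : Node) a => qval (qmul u.2 a)) V Λ) ×ˢ
      V).Finite := ((hVfin.image2 _ hΛ).insert _).prod hVfin
  obtain ⟨N, hN⟩ := exists_norm_bound hXfin fun x w => x.1 = sanovMat w * qval x.2.2
  let E : Set Edge := {e | (e.1 ∈ V ∧ e.2.1 ∈ sanovBall N ∧ e.2.2 ∈ V) ∧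
    ∃ k, Path e.1.1 k e.2.2.1 ∧ qval e.1.2 * qval k = ival e.2.1 * qval e.2.2.2}
  have hEfin : E.Finite := (hVfin.prod ((sanovBall N).finite_toSet.prod hVfin)).subset
    fun e he => ⟨he.1.1, he.1.2.1, he.1.2.2⟩
  refine ⟨(N, (hVfin.toFinset.toList, hEfin.toFinset.toList)), ⟨?_, ?_⟩, ?_, ?_, ?_⟩
  · simp [hVdef]
  · intro u hu
    simp only [Finset.mem_toList, Set.Finite.mem_toFinset] at hu ⊢
    refine ⟨⟨hu, mem_sanovBall.2 ⟨1, by simp, by rw [map_one, entries_one]⟩, hu⟩, qone, .refl, ?_⟩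
    simp [qval_qone, ival_ione]
  · intro u hu t ht
    simp only [Finset.mem_toList, Set.Finite.mem_toFinset] at hu ⊢
    have hpath := (hV u hu).step t ht
    have hden := hpath.den_ne_zero hs
    rw [or_iff_not_imp_left, exceeds_iff hden hg, not_lt]
    intro hle
    obtain ⟨v, hv, hvt, hw⟩ := hcover _ _ hpath (hle.trans (le_max_right _ _))
    have hvV : v ∈ V := Set.mem_insert_of_mem _ hv
    obtain ⟨w, hwN, hw⟩ := hN (qval (qmul u.2 t.1), v)
      ⟨Or.inr ⟨u, hu, t.1, ⟨_, _, hV u hu, t, ht, rfl⟩, rfl⟩, hvV⟩ hw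
    have hball : entries (sanov w) ∈ sanovBall N := mem_sanovBall.2 ⟨w, hwN, rfl⟩
    refine ⟨v, hvV, ⟨hvt, hVden v hvV⟩, entries (sanov w), hball,
      ⟨⟨hu, hball, hvV⟩, t.1, ?_, ?_⟩, ?_⟩
    · rw [hvt]
      exact Path.single ht
    · rw [← qval_qmul]
      exact hw
    · rw [qEq_iff hden (by exact hVden v hvV), qval_qlmul]
      exact hw
  · intro e he f hf hef hball
    simp only [Finset.mem_toList, Set.Finite.mem_toFinset] at he hf ⊢
    obtain ⟨⟨he1, -, -⟩, k, hk, hek⟩ := he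
    obtain ⟨⟨-, -, hf3⟩, l, hl, hfl⟩ := hf
    rw [← hef] at hl hfl
    refine ⟨⟨he1, hball, hf3⟩, qmul k l, hk.trans hl, ?_⟩
    rw [qval_qmul, ival_imul, ← mul_assoc, hek, mul_assoc, hfl, mul_assoc]
  · intro u hu hnil
    simp only [Finset.mem_toList, Set.Finite.mem_toFinset] at hu ⊢
    rw [or_iff_not_imp_left, not_not]
    intro heq
    have hdet := (hV u hu).one_le_abs_det hs
    have hidet : idet u.2.1 ≠ 0 := by
      intro h0
      rw [det_qval, h0] at hdet
      norm_num at hdet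
    obtain ⟨w, hwN, hw⟩ := hN (qval g, u) ⟨Or.inl rfl, hu⟩
      ((sanovEquiv_iff (hVden u hu) hg hidet).1 heq)
    refine ⟨entries (sanov w), mem_sanovBall.2 ⟨w, hwN, rfl⟩, ?_, ?_⟩
    · rw [qEq_iff (by exact hVden u hu) hg, qval_qlmul]
      exact hw.symm
    · rintro ⟨-, k, hk, hkw⟩
      refine hmem (mem_stackSet_iff.2 ⟨k, ?_, ?_⟩)
      · rw [← hnil]
        exact hk
      · rw [qval_qone, one_mul] at hkw
        rw [hkw]
        exact hw.symm

end FlatRat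

namespace FlatRat

open Matrix

/-! ### Expressions for rational and flat rational sets -/

theorem IsRational.exists_ratSet {M : Type*} [Monoid M] {L : Set M} (hL : IsRational L) :
    ∃ E : RegularExpression M, ratSet E = L := by
  induction hL with
  | finite L hL =>
    induction L, hL using Set.Finite.induction_on with
    | empty => exact ⟨.zero, rfl⟩
    | @insert a S _ _ ih =>
      obtain ⟨E, rfl⟩ := ih
      exact ⟨.plus (.char a) E, rfl⟩
  | union K L _ _ hK hL =>
    obtain ⟨E, rfl⟩ := hK
    obtain ⟨F, rfl⟩ := hL
    exact ⟨.plus E F, rfl⟩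
  | mul K L _ _ hK hL =>
    obtain ⟨E, rfl⟩ := hK
    obtain ⟨F, rfl⟩ := hL
    exact ⟨.comp E F, rfl⟩
  | star L _ hL =>
    obtain ⟨E, rfl⟩ := hL
    exact ⟨.star E, rfl⟩

theorem exists_map_eq_of_forall_mem {β γ : Type*} {f : β → γ} (l : List γ)
    (h : ∀ c ∈ l, ∃ b, f b = c) : ∃ m : List β, m.map f = l := by
  induction l with
  | nil => exact ⟨[], rfl⟩
  | cons c l ih =>
    obtain ⟨b, rfl⟩ := h c (by simp)
    obtain ⟨m, rfl⟩ := ih fun c hc => h c (List.mem_cons_of_mem _ hc)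
    exact ⟨b :: m, rfl⟩

theorem IsFlatRational.exists_flatSet {M : Type*} [Monoid M] {N : Submonoid M} {R : Set M}
    (hR : IsFlatRational N R) : ∃ E : FlatExpr M N, flatSet N E = R := by
  obtain ⟨F, hF, rfl⟩ := hR
  let term : RegularExpression N × List (M × RegularExpression N) → Set N × List (M × Set N) :=
    fun T => (ratSet T.1, T.2.map fun p => (p.1, ratSet p.2))
  obtain ⟨E, rfl⟩ : ∃ E : FlatExpr M N, E.map term = F := by
    refine exists_map_eq_of_forall_mem F fun T hT => ?_
    obtain ⟨h1, h2⟩ := hF T hT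
    obtain ⟨E₀, hE₀⟩ := h1.exists_ratSet
    obtain ⟨l, hl⟩ := exists_map_eq_of_forall_mem
      (f := fun p : M × RegularExpression N => (p.1, ratSet p.2)) T.2 fun p hp => by
        obtain ⟨E, hE⟩ := (h2 p hp).exists_ratSet
        exact ⟨(p.1, E), by rw [hE]⟩
    exact ⟨(E₀, l), Prod.ext hE₀ hl⟩
  refine ⟨E, ?_⟩
  ext x
  simp only [flatSet, Set.mem_iUnion, exists_prop, List.mem_map, exists_exists_and_eq_and, term]

theorem image_ratSet {M N : Type*} [Monoid M] [Monoid N] (f : M →* N) (E : RegularExpression M) :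
    f '' ratSet E = ratSet (E.map f) := by
  induction E with
  | zero => exact Set.image_empty _
  | epsilon => simp [ratSet, RegularExpression.map]
  | char a => simp [ratSet, RegularExpression.map]
  | plus E F hE hF => simp only [ratSet, RegularExpression.map, Set.image_union, hE, hF]
  | comp E F hE hF => simp only [ratSet, RegularExpression.map, Set.image_mul, hE, hF]
  | star E hE =>
    simp only [ratSet, RegularExpression.map, ← hE, ← MonoidHom.map_mclosure, Submonoid.coe_map]

/-! ### Descriptions of matrices in `GL(2,ℚ)` -/

theorem commonDen_matCode_ne_zero (g : GL (Fin 2) ℚ) : (commonDen (matCode g)).2 ≠ 0 := by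
  simp [commonDen, matCode, ratCode]

theorem qval_commonDen_matCode (g : GL (Fin 2) ℚ) : qval (commonDen (matCode g)) = g.1 := by
  have h (q : ℚ) : (q.den : ℚ) ≠ 0 := by simp
  have e (q : ℚ) : (q.num : ℚ) = q * q.den := (Rat.mul_den_eq_num q).symm
  have h00 := h (g.1 0 0)
  have h01 := h (g.1 0 1)
  have h10 := h (g.1 1 0)
  have h11 := h (g.1 1 1)
  ext i j
  fin_cases i <;> fin_cases j <;>
    · simp only [qval, commonDen, matCode, ratCode]
      simp
      rw [e]
      field_simp

theorem commonDen_clearDen (a : MatCode) : commonDen (clearDen a) = ((commonDen a).1, 1) := by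
  simp [commonDen, clearDen]

/-- The cleared matrix is integral with nonzero determinant, so it has denominator `1` and `|det| ≥
1`. This is why the separators `g_i` may be treated as further letters from `P(2,ℚ)`. -/
theorem admissible_clearDen (g : GL (Fin 2) ℚ) : Admissible (commonDen (clearDen (matCode g))) := by
  rw [commonDen_clearDen]
  have h0 : idet (commonDen (matCode g)).1 ≠ 0 := by
    intro h0
    have h1 := det_qval (commonDen (matCode g))
    rw [h0, qval_commonDen_matCode] at h1
    simp at h1
    exact g.det_ne_zero h1
  have : (idet (commonDen (matCode g)).1).natAbs ≠ 0 := by simpa using h0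
  refine ⟨by simp, ?_⟩
  simp only [mul_one, true_and]
  omega

/-- For a matrix in `GL(2,ℤ)` the fractions are reduced, so all four denominators, and with them the
common one, are `1`, as `Admissible` requires in the case of determinant `±1`. -/
theorem admissible_matCode (h : P2Q) : Admissible (commonDen (matCode h)) := by
  refine ⟨commonDen_matCode_ne_zero _, ?_⟩
  have habs := abs_det_qval (commonDen (matCode h))
  have hpos : (0 : ℚ) < (((commonDen (matCode h)).2 * (commonDen (matCode h)).2 : ℕ) : ℚ) := by
    exact_mod_cast Nat.pos_of_ne_zero
      (mul_ne_zero (commonDen_matCode_ne_zero _) (commonDen_matCode_ne_zero _))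
  rw [qval_commonDen_matCode] at habs
  rcases h.2 with h1 | h1
  · left
    have h2 : 1 < |(h.1.1 : Matrix (Fin 2) (Fin 2) ℚ).det| := h1
    rw [habs, one_lt_div hpos] at h2
    exact_mod_cast h2
  · right
    have hden : (commonDen (matCode h)).2 = 1 := by
      obtain ⟨a, ha⟩ := h1
      have (i j : Fin 2) : (h.1.1 i j).den = 1 := by
        rw [← ha]
        simp
      simp [commonDen, matCode, ratCode, this]
    refine ⟨hden, ?_⟩
    rw [abs_det_of_mem_GL2Z h1, hden] at habs
    simp only [mul_one, Nat.cast_one, div_one] at habs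
    exact_mod_cast habs.symm

/-! ### From flat expressions to admissible stacks -/

/-- All letters of an expression satisfy `A`. -/
def AllLetters {β : Type*} (A : β → Prop) : RegularExpression β → Prop
  | .zero => True
  | .epsilon => True
  | .char a => A a
  | .plus E F => AllLetters A E ∧ AllLetters A F
  | .comp E F => AllLetters A E ∧ AllLetters A F
  | .star E => AllLetters A E

theorem allLetters_map {β γ : Type*} {A : γ → Prop} {f : β → γ} (hf : ∀ b, A (f b))
    (E : RegularExpression β) : AllLetters A (E.map f) := by
  induction E with
  | zero => trivial
  | epsilon => trivial
  | char a => exact hf a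
  | plus E F hE hF => exact ⟨hE, hF⟩
  | comp E F hE hF => exact ⟨hE, hF⟩
  | star E hE => exact hE

/-- Unfolding only rearranges subexpressions, so the letters on the stack always come from the
initial one; the remaining matrices split off are the identity. -/
theorem isAdmissible_of_allLetters {s : Stack}
    (hs : ∀ E ∈ s, AllLetters (fun a => Admissible (commonDen a)) E) : IsAdmissible s := by
  have step : ∀ t : Stack, (∀ E ∈ t, AllLetters (fun a => Admissible (commonDen a)) E) →
      ∀ p ∈ next t, Admissible p.1 ∧
        ∀ E ∈ p.2, AllLetters (fun a => Admissible (commonDen a)) E := by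
    intro t ht p hp
    match t with
    | [] => simp [next] at hp
    | E :: r =>
      have hE := ht E (by simp)
      have hr := fun F hF => ht F (List.mem_cons_of_mem E hF)
      cases E with
      | zero => simp [next, unfoldHead] at hp
      | epsilon =>
        simp only [next, unfoldHead, List.mem_singleton] at hp
        subst hp
        exact ⟨admissible_qone, hr⟩
      | char a =>
        simp only [next, unfoldHead, List.mem_singleton] at hp
        subst hp
        exact ⟨hE, hr⟩
      | plus E F =>
        simp only [next, unfoldHead, List.mem_cons, List.not_mem_nil, or_false] at hp
        rcases hp with rfl | rfl
        · exact ⟨admissible_qone, List.forall_mem_cons.2 ⟨hE.1, hr⟩⟩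
        · exact ⟨admissible_qone, List.forall_mem_cons.2 ⟨hE.2, hr⟩⟩
      | comp E F =>
        simp only [next, unfoldHead, List.mem_singleton] at hp
        subst hp
        exact ⟨admissible_qone,
          List.forall_mem_cons.2 ⟨hE.1, List.forall_mem_cons.2 ⟨hE.2, hr⟩⟩⟩
      | star E =>
        simp only [next, unfoldHead, List.mem_cons, List.not_mem_nil, or_false] at hp
        rcases hp with rfl | rfl
        · exact ⟨admissible_qone, hr⟩
        · exact ⟨admissible_qone, List.forall_mem_cons.2 ⟨hE, ht⟩⟩
  intro k t h
  have : ∀ E ∈ t, AllLetters (fun a => Admissible (commonDen a)) E := by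
    induction h with
    | refl => exact hs
    | step p _ hp ih => exact (step _ ih p hp).2
  exact fun p hp => (step t this p hp).1

/-- The description of a term. -/
def termCode (T : RegularExpression P2Q × List (GL (Fin 2) ℚ × RegularExpression P2Q)) : Term :=
  (T.1.map fun h : P2Q => matCode h,
    T.2.map fun p => (matCode p.1, p.2.map fun h : P2Q => matCode h))

theorem flatCode_eq (E : FlatExpr (GL (Fin 2) ℚ) P2Q) : flatCode E = E.map termCode := rfl

theorem isAdmissible_termCode
    (T : RegularExpression P2Q × List (GL (Fin 2) ℚ × RegularExpression P2Q)) :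
    IsAdmissible (termStack (termCode T)) := by
  refine isAdmissible_of_allLetters fun E hE => ?_
  have hP (F : RegularExpression P2Q) : AllLetters (fun a => Admissible (commonDen a))
      (F.map fun h : P2Q => matCode h) :=
    allLetters_map (A := fun a => Admissible (commonDen a)) admissible_matCode F
  rcases List.mem_cons.1 hE with rfl | hE
  · exact hP _
  · obtain ⟨p, hp, hE⟩ := List.mem_flatMap.1 hE
    obtain ⟨q, -, rfl⟩ := List.mem_map.1 hp
    simp only [List.mem_cons, List.not_mem_nil, or_false] at hE
    rcases hE with rfl | rfl
    · exact admissible_clearDen q.1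
    · exact hP _

theorem exprSet_map_matCode (E : RegularExpression P2Q) :
    exprSet (E.map fun h : P2Q => matCode h) =
      (fun h : GL (Fin 2) ℚ => h.1) '' ((↑) '' ratSet E : Set (GL (Fin 2) ℚ)) := by
  have h := image_ratSet ((Units.coeHom (Matrix (Fin 2) (Fin 2) ℚ)).comp P2Q.subtype) E
  rw [exprSet, RegularExpression.map_map, Set.image_image]
  have he : ((fun a => qval (commonDen a)) ∘ fun h : P2Q => matCode h) =
      ((Units.coeHom (Matrix (Fin 2) (Fin 2) ℚ)).comp P2Q.subtype) := by
    funext h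
    exact qval_commonDen_matCode h
  rw [he, ← h]
  rfl

theorem qval_commonDen_clearDen (g : GL (Fin 2) ℚ) :
    qval (commonDen (clearDen (matCode g))) = ((commonDen (matCode g)).2 : ℚ) • g.1 := by
  have h : ((commonDen (matCode g)).2 : ℚ) ≠ 0 := by exact_mod_cast commonDen_matCode_ne_zero g
  rw [commonDen_clearDen, ← qval_commonDen_matCode, qval_eq_smul, qval_eq_smul, smul_inv_smul₀ h]
  simp

theorem termDen_ne_zero
    (T : RegularExpression P2Q × List (GL (Fin 2) ℚ × RegularExpression P2Q)) :
    termDen (termCode T) ≠ 0 := by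
  obtain ⟨E, l⟩ := T
  induction l with
  | nil => exact one_ne_zero
  | cons p l ih => exact mul_ne_zero (commonDen_matCode_ne_zero p.1) ih

/-- The common denominators are scalars and commute with everything, so they can be pulled out of
the product, where they accumulate to `termDen`. -/
theorem mem_stackSet_flatMap_iff (E : RegularExpression P2Q)
    (l : List (GL (Fin 2) ℚ × RegularExpression P2Q)) (x : Matrix (Fin 2) (Fin 2) ℚ) :
    x ∈ stackSet ((termCode (E, l)).2.flatMap fun p => [.char (clearDen p.1), p.2]) ↔
      ∃ h ∈ ((l.map fun p => (p.1, ratSet p.2)).map fun p =>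
        ({p.1} : Set (GL (Fin 2) ℚ)) * ((↑) '' p.2 : Set (GL (Fin 2) ℚ))).prod,
        x = (termDen (termCode (E, l)) : ℚ) • h.1 := by
  induction l generalizing x with
  | nil =>
    have hden : termDen (termCode (E, [])) = 1 := rfl
    rw [hden]
    simp [termCode, stackSet]
  | cons p l ih =>
    have hst : stackSet ((termCode (E, p :: l)).2.flatMap fun p => [.char (clearDen p.1), p.2]) =
        {qval (commonDen (clearDen (matCode p.1)))} *
          (exprSet (p.2.map fun h : P2Q => matCode h) *
            stackSet ((termCode (E, l)).2.flatMap fun p => [.char (clearDen p.1), p.2])) := by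
      simp only [termCode, List.map_cons, List.flatMap_cons, List.cons_append, List.nil_append,
        stackSet_cons]
      rfl
    have hden : (termDen (termCode (E, p :: l)) : ℚ) =
        (commonDen (matCode p.1)).2 * termDen (termCode (E, l)) := by
      rw [← Nat.cast_mul]
      rfl
    rw [hst, qval_commonDen_clearDen, exprSet_map_matCode, hden]
    simp only [List.map_cons, List.prod_cons]
    constructor
    · rintro ⟨_, rfl, _, ⟨_, ⟨e, he, rfl⟩, y, hy, rfl⟩, rfl⟩
      obtain ⟨h, hh, rfl⟩ := (ih y).1 hy
      refine ⟨p.1 * e * h, Set.mul_mem_mul (Set.mul_mem_mul rfl he) hh, ?_⟩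
      simp only [Units.val_mul, Matrix.smul_mul, Matrix.mul_smul, smul_smul, mul_assoc,
        mul_comm (termDen _ : ℚ)]
    · rintro ⟨_, ⟨_, ⟨_, rfl, e, he, rfl⟩, h, hh, rfl⟩, rfl⟩
      refine ⟨_, rfl, _, ⟨_, ⟨e, he, rfl⟩, _, (ih _).2 ⟨h, hh, rfl⟩, rfl⟩, ?_⟩
      simp only [Units.val_mul, Matrix.smul_mul, Matrix.mul_smul, smul_smul, mul_assoc,
        mul_comm (termDen _ : ℚ)]

theorem qval_termTarget_mem_iff (g : GL (Fin 2) ℚ)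
    (T : RegularExpression P2Q × List (GL (Fin 2) ℚ × RegularExpression P2Q)) :
    qval (termTarget (matCode g) (termCode T)) ∈ stackSet (termStack (termCode T)) ↔
      g ∈ flatProduct P2Q (ratSet T.1) (T.2.map fun p => (p.1, ratSet p.2)) := by
  have hd : (termDen (termCode T) : ℚ) ≠ 0 := by exact_mod_cast termDen_ne_zero T
  have htarget : qval (termTarget (matCode g) (termCode T)) =
      (termDen (termCode T) : ℚ) • g.1 := by
    rw [← qval_commonDen_matCode g, qval_eq_smul, qval_eq_smul, termTarget, ival_ismul, smul_comm]
    simp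
  rw [htarget, termStack, stackSet_cons, flatProduct]
  have hE : (termCode T).1 = T.1.map fun h : P2Q => matCode h := rfl
  rw [hE, exprSet_map_matCode]
  constructor
  · rintro ⟨_, ⟨e, he, rfl⟩, y, hy, hey⟩
    obtain ⟨h, hh, rfl⟩ := (mem_stackSet_flatMap_iff T.1 T.2 y).1 hy
    refine ⟨e, he, h, hh, Units.ext ?_⟩
    simp only [Matrix.mul_smul] at hey
    exact smul_right_injective _ hd hey
  · rintro ⟨e, he, h, hh, rfl⟩
    refine ⟨_, ⟨e, he, rfl⟩, _, (mem_stackSet_flatMap_iff T.1 T.2 _).2 ⟨h, hh, rfl⟩, ?_⟩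
    simp only [Matrix.mul_smul, Units.val_mul]

/-! ### The decision procedure -/

section Decision

set_option synthInstance.maxSize 1000

/-- The inputs of the decision procedure. -/
abbrev Input : Type := MatCode × FlatExpr MatCode MatCode

/-- Membership is witnessed after `n` steps. -/
def Accepts (i : Input) (n : ℕ) : Prop :=
  ∃ T ∈ i.2, HitAt (termStack T) (termTarget i.1 T) n

/-- Nonmembership is certified by the object with number `n`, or the input is seen to be malformed
after `n` steps. -/
def Rejects (i : Input) (n : ℕ) : Prop :=
  ((commonDen i.1).2 = 0 ∨ ∃ T ∈ i.2, BadAt (termStack T) n) ∨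
    ∀ T ∈ i.2, ∃ c ∈ (Encodable.decode (α := List (Term × Cert)) n).getD [],
      c.1 = T ∧ c.2.Refutes (termStack T) (termTarget i.1 T)

theorem primrecRel_accepts : PrimrecRel Accepts :=
  primrecPred_exists_mem (P := fun (p : Input × ℕ) (T : Term) =>
    HitAt (termStack T) (termTarget p.1.1 T) p.2) (Primrec.snd.comp Primrec.fst)
    (primrecPred_hitAt (primrec_termStack.comp Primrec.snd)
      (primrec_termTarget.comp (Primrec.fst.comp (Primrec.fst.comp Primrec.fst)) Primrec.snd)
      (Primrec.snd.comp Primrec.fst))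

theorem primrecRel_rejects : PrimrecRel Rejects := by
  have hT : Primrec fun p : Input × ℕ => p.1.2 := Primrec.snd.comp Primrec.fst
  refine ((Primrec.eq.comp (Primrec.snd.comp (primrec_commonDen.comp
    (Primrec.fst.comp Primrec.fst))) (Primrec.const 0)).or ?_).or ?_
  · exact primrecPred_exists_mem (P := fun (p : Input × ℕ) (T : Term) =>
      BadAt (termStack T) p.2) hT (primrecPred_badAt (primrec_termStack.comp Primrec.snd)
        (Primrec.snd.comp Primrec.fst))
  · refine primrecPred_forall_mem (P := fun (p : Input × ℕ) (T : Term) =>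
      ∃ c ∈ (Encodable.decode (α := List (Term × Cert)) p.2).getD [],
        c.1 = T ∧ c.2.Refutes (termStack T) (termTarget p.1.1 T)) hT ?_
    refine primrecPred_exists_mem (P := fun (p : (Input × ℕ) × Term) (c : Term × Cert) =>
      c.1 = p.2 ∧ c.2.Refutes (termStack p.2) (termTarget p.1.1.1 p.2))
      (Primrec.option_getD.comp (Primrec.decode.comp (Primrec.snd.comp Primrec.fst))
        (Primrec.const [])) ?_
    have h2 : Primrec fun p : ((Input × ℕ) × Term) × (Term × Cert) => p.1.2 :=
      Primrec.snd.comp Primrec.fst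
    have h3 : Primrec fun p : ((Input × ℕ) × Term) × (Term × Cert) => p.1.1.1.1 :=
      Primrec.fst.comp (Primrec.fst.comp (Primrec.fst.comp Primrec.fst))
    exact (Primrec.eq.comp (Primrec.fst.comp Primrec.snd) h2).and
      (primrecPred_refutes (primrec_termStack.comp h2) (primrec_termTarget.comp h3 h2)
        (Primrec.snd.comp Primrec.snd))

theorem isAdmissible_iff {s : Stack} : IsAdmissible s ↔ ∀ n, ¬BadAt s n := by
  constructor
  · rintro hs n ⟨u, hu, t, ht, h⟩
    exact h (hs u.2 u.1 (path_iff_exists_mem_reachAt.2 ⟨n, hu⟩) t ht)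
  · intro hs k t hk p hp
    obtain ⟨n, hn⟩ := path_iff_exists_mem_reachAt.1 hk
    by_contra h
    exact hs n ⟨_, hn, p, hp, h⟩

theorem mem_stackSet_iff_exists_hitAt {s : Stack} {g : QMat} (hs : IsAdmissible s)
    (hg : g.2 ≠ 0) : qval g ∈ stackSet s ↔ ∃ n, HitAt s g n := by
  rw [mem_stackSet_iff]
  constructor
  · rintro ⟨k, hk, hkg⟩
    obtain ⟨n, hn⟩ := path_iff_exists_mem_reachAt.1 hk
    exact ⟨n, _, hn, rfl, (qEq_iff (hk.den_ne_zero hs) hg).2 hkg⟩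
  · rintro ⟨n, ⟨t, k⟩, hu, hnil, hq⟩
    have hk : Path s k t := path_iff_exists_mem_reachAt.2 ⟨n, hu⟩
    obtain rfl : t = [] := hnil
    exact ⟨k, hk, (qEq_iff (hk.den_ne_zero hs) hg).1 hq⟩

/-- The search has to stop on every code, including those that do not describe matrices of the
required kind. A zero denominator or an inadmissible letter shows up after finitely many steps.
Otherwise either some path hits the target or every term has a certificate. -/
theorem exists_accepts_or_rejects (i : Input) : ∃ n, Accepts i n ∨ Rejects i n := by
  by_cases hg : (commonDen i.1).2 = 0
  · exact ⟨0, Or.inr (Or.inl (Or.inl hg))⟩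
  by_cases hbad : ∃ n, ∃ T ∈ i.2, BadAt (termStack T) n
  · obtain ⟨n, h⟩ := hbad
    exact ⟨n, Or.inr (Or.inl (Or.inr h))⟩
  have hadm : ∀ T ∈ i.2, IsAdmissible (termStack T) := fun T hT =>
    isAdmissible_iff.2 fun n hn => hbad ⟨n, T, hT, hn⟩
  by_cases hhit : ∃ n, Accepts i n
  · obtain ⟨n, h⟩ := hhit
    exact ⟨n, Or.inl h⟩
  have hcert : ∀ T, ∃ c : Cert, T ∈ i.2 → c.Refutes (termStack T) (termTarget i.1 T) := by
    intro T
    by_cases hT : T ∈ i.2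
    · obtain ⟨c, hc⟩ := exists_refutes (g := termTarget i.1 T) (hadm T hT) hg (fun hmem => by
        obtain ⟨n, hn⟩ := (mem_stackSet_iff_exists_hitAt (g := termTarget i.1 T)
          (hadm T hT) hg).1 hmem
        exact hhit ⟨n, T, hT, hn⟩)
      exact ⟨c, fun _ => hc⟩
    · exact ⟨(0, ([], [])), fun h => absurd h hT⟩
  choose c hc using hcert
  -- One number encodes the certificates of all terms at once, each paired with its term.
  refine ⟨Encodable.encode (i.2.map fun T => (T, c T)), Or.inr (Or.inr fun T hT => ?_)⟩
  rw [Encodable.encodek]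
  exact ⟨(T, c T), List.mem_map.2 ⟨T, hT, rfl⟩, rfl, hc T hT⟩

theorem mem_flatSet_iff {E : FlatExpr (GL (Fin 2) ℚ) P2Q} {g : GL (Fin 2) ℚ} :
    g ∈ flatSet P2Q E ↔ ∃ T ∈ flatCode E,
      qval (termTarget (matCode g) T) ∈ stackSet (termStack T) := by
  rw [flatCode_eq]
  simp only [flatSet, Set.mem_iUnion, exists_prop, List.mem_map, exists_exists_and_eq_and,
    qval_termTarget_mem_iff]

theorem mem_of_accepts {E : FlatExpr (GL (Fin 2) ℚ) P2Q} {g : GL (Fin 2) ℚ} {n : ℕ}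
    (h : Accepts (matCode g, flatCode E) n) : g ∈ flatSet P2Q E := by
  obtain ⟨T, hT, hn⟩ := h
  refine mem_flatSet_iff.2 ⟨T, hT, ?_⟩
  obtain ⟨T, -, rfl⟩ := List.mem_map.1 hT
  exact (mem_stackSet_iff_exists_hitAt (g := termTarget (matCode g) (termCode T))
    (isAdmissible_termCode T)
    (commonDen_matCode_ne_zero g)).2 ⟨n, hn⟩

theorem notMem_of_rejects {E : FlatExpr (GL (Fin 2) ℚ) P2Q} {g : GL (Fin 2) ℚ} {n : ℕ}
    (h : Rejects (matCode g, flatCode E) n) : g ∉ flatSet P2Q E := by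
  rw [mem_flatSet_iff]
  rintro ⟨T, hT, hmem⟩
  have hadm : ∀ T ∈ flatCode E, IsAdmissible (termStack T) := by
    intro T hT
    obtain ⟨T, -, rfl⟩ := List.mem_map.1 hT
    exact isAdmissible_termCode T
  rcases h with (h | ⟨T', hT', hbad⟩) | h
  · exact commonDen_matCode_ne_zero g h
  · exact isAdmissible_iff.1 (hadm T' hT') n hbad
  · obtain ⟨c, -, -, hc⟩ := h T hT
    exact hc.notMem (hadm T hT) (by exact commonDen_matCode_ne_zero g) hmem

end Decision

end FlatRat

/-! ### The decidability theorem -/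

/-- There is one algorithm such that, for every flat rational subset `R` of `GL(2,ℚ)` relative to
`P(2,ℚ)`: the set `R` is described by some flat rational expression, and, given the description of
any such expression for `R` and of any `g ∈ GL(2,ℚ)`, the algorithm decides whether `g ∈ R`. -/
theorem mainTheorem3 :
    ∃ decider : FlatRat.MatCode × FlatRat.FlatExpr FlatRat.MatCode FlatRat.MatCode → Bool,
      Computable decider ∧
      ∀ R : Set (Matrix.GeneralLinearGroup (Fin 2) ℚ),
        FlatRat.IsFlatRational FlatRat.P2Q R →
          (∃ E : FlatRat.FlatExpr (Matrix.GeneralLinearGroup (Fin 2) ℚ) FlatRat.P2Q,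
            FlatRat.flatSet FlatRat.P2Q E = R) ∧
          ∀ E : FlatRat.FlatExpr (Matrix.GeneralLinearGroup (Fin 2) ℚ) FlatRat.P2Q,
            FlatRat.flatSet FlatRat.P2Q E = R →
            ∀ g : Matrix.GeneralLinearGroup (Fin 2) ℚ,
              decider (FlatRat.matCode g, FlatRat.flatCode E) = true ↔ g ∈ R := by
  obtain ⟨f, hf, hspec⟩ := FlatRat.exists_computable_search FlatRat.primrecRel_accepts
    FlatRat.primrecRel_rejects FlatRat.exists_accepts_or_rejects
  refine ⟨f, hf, fun R hR => ⟨hR.exists_flatSet, ?_⟩⟩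
  rintro E rfl g
  -- Either answer of the search comes with a sound witness, so the answer settles membership in
  -- both directions.
  obtain ⟨n, ⟨h1, h2⟩ | ⟨h1, h2⟩⟩ := hspec (FlatRat.matCode g, FlatRat.flatCode E)
  · exact iff_of_true h1 (FlatRat.mem_of_accepts h2)
  · exact iff_of_false (by simp [h1]) (FlatRat.notMem_of_rejects h2)
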